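/- Let $n\ge 3$, let $F_n$ be the free group on $x_1,\dots,x_n$ with indices taken modulo $n$, and let $\mathrm{Out}(F_n)=\mathrm{Aut}(F_n)/\mathrm{Inn}(F_n)$. Let $r_i,l_i,n_i\in\mathrm{Aut}(F_n)$ be the transvections $r_i: x_{i+1}\mapsto x_{i+1}x_i$, $l_i: x_{i+1}\mapsto x_ix_{i+1}$, $n_i: x_{i+2}\mapsto x_{i+2}x_i$ (each fixing all other generators). Let $\mathcal H$ be the finite family consisting of the subgroups $\langle\phi_i,\phi_j\rangle$ with $\phi_i\in\{r_i,l_i\}$, $\phi_j\in\{r_j,l_j\}$ and $\mathrm{dist}_{\mathbb Z/n\mathbb Z}(i,j)\ge 2$, and of the subgroups $\langle r_i,l_i\rangle$, $\langle n_i,r_i\rangle$, $\langle n_i,l_{i+1}\rangle$ for all $i$; let $\overline{\mathcal H}$ be the family of their images in $\mathrm{Out}(F_n)$. Then $\mathrm{Aut}(F_n)$ and $\mathrm{Out}(F_n)$ are algebraically thick of order at most one. More precisely, they are finitely generated, every member of $\mathcal H$ and of $\overline{\mathcal H}$ is isomorphic to $\mathbb Z^2$, and for every finite generating set of $\mathrm{Aut}(F_n)$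 (respectively $\mathrm{Out}(F_n)$) there is $M>0$ such that the group, with the corresponding word metric, is $M$-algebraically thick of order at most one with respect to $\mathcal H$ (respectively $\overline{\mathcal H}$). Here a finitely generated group $G$ with a word metric is *$M$-algebraically thick of order at most one with respect to* a finite non-empty collection $\mathcal H$ of subgroups if: (0) each $H\in\mathcal H$ is finitely generated and undistorted in $G$ (word metrics of $H$ are bi-Lipschitz equivalent to the restrictions to $H$ of word metrics of $G$); (1) there is a finite index subgroup $G_1\le G$ such that every element of $G$ is at distance less than $M$ from $G_1$, and $G_1$ has a finite generating set contained in $\bigcup_{H\in\mathcal H}H$; (2) any $H,H'\in\mathcal H$ are joined by a finite sequence $H=H_1,\dots,H_k=H'$ in $\mathcal H$ with every $H_i\cap H_{i+1}$ infinite; (3) each $H\in\mathcal H$ is unconstricted: with a word metric, there are a non-principal ultrafilter $\omega$ on $\mathbb N$ and scaling constants $d_i>0$ with $\lim_\omega d_i=\infty$ such that for every sequence $b$ of observation points the asymptotic cone $\mathrm{Cone}_\omega(H,b,d)$ has no cut-point (the point of a singleton counts as a cut-point), and there is a constant $c$ such that every point of $H$ is within distance $c$ of a bi-infinite geodesic (of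 the Cayley graph). $G$ is *algebraically thick of order at most one* if this holds for some word metric on $G$, some $M>0$ and some such $\mathcal H$. -/

import Mathlib

open Filter Topology
open scoped NNReal

noncomputable section

universe u

/-! ### Word metrics -/

section WordMetric

variable {G : Type u} [Group G]

/-- The lengths of the words in `S ∪ S⁻¹` that represent `g`. -/
def wordLengths (S : Set G) (g : G) : Set ℕ :=
  {k | ∃ w : List G, (∀ x ∈ w, x ∈ S ∨ x⁻¹ ∈ S) ∧ w.prod = g ∧ w.length = k}

/-- The word length of `g` with respect to `S` (used only for generating sets `S`). -/
def wordNorm (S : Set G) (g : G) : ℕ := sInf (wordLengths S g)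

theorem wordLengths_nonempty {S : Set G} (hS : Subgroup.closure S = ⊤) (g : G) :
    (wordLengths S g).Nonempty := by
  have hg : g ∈ Subgroup.closure S := hS ▸ Subgroup.mem_top g
  rw [← Subgroup.mem_toSubmonoid, Subgroup.closure_toSubmonoid] at hg
  obtain ⟨w, hw, hp⟩ := Submonoid.exists_list_of_mem_closure hg
  exact ⟨w.length, w, hw, hp, rfl⟩

theorem exists_word {S : Set G} (hS : Subgroup.closure S = ⊤) (g : G) :
    ∃ w : List G, (∀ x ∈ w, x ∈ S ∨ x⁻¹ ∈ S) ∧ w.prod = g ∧ w.length = wordNorm S g :=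
  Nat.sInf_mem (wordLengths_nonempty hS g)

theorem wordNorm_one (S : Set G) : wordNorm S 1 = 0 :=
  Nat.sInf_eq_zero.2 (Or.inl ⟨[], by simp⟩)

theorem eq_one_of_wordNorm {S : Set G} (hS : Subgroup.closure S = ⊤) {g : G}
    (h : wordNorm S g = 0) : g = 1 := by
  obtain ⟨w, -, hp, hl⟩ := exists_word hS g
  rw [h, List.length_eq_zero_iff] at hl
  rw [← hp, hl, List.prod_nil]

theorem wordNorm_mul_le {S : Set G} (hS : Subgroup.closure S = ⊤) (g h : G) :
    wordNorm S (g * h) ≤ wordNorm S g + wordNorm S h := by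
  obtain ⟨v, hv, hvp, hvl⟩ := exists_word hS g
  obtain ⟨w, hw, hwp, hwl⟩ := exists_word hS h
  refine Nat.sInf_le ⟨v ++ w, ?_, by rw [List.prod_append, hvp, hwp], by
    rw [List.length_append, hvl, hwl]⟩
  intro x hx
  rcases List.mem_append.1 hx with hx | hx
  exacts [hv x hx, hw x hx]

theorem wordNorm_inv_le {S : Set G} (hS : Subgroup.closure S = ⊤) (g : G) :
    wordNorm S g⁻¹ ≤ wordNorm S g := by
  obtain ⟨v, hv, hvp, hvl⟩ := exists_word hS g
  refine Nat.sInf_le ⟨(v.map (fun x => x⁻¹)).reverse, ?_, ?_, by simp [hvl]⟩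
  · intro x hx
    simp only [List.mem_reverse, List.mem_map] at hx
    obtain ⟨y, hy, rfl⟩ := hx
    rw [inv_inv]
    exact (hv y hy).symm
  · rw [← hvp, List.prod_inv_reverse]

theorem wordNorm_inv {S : Set G} (hS : Subgroup.closure S = ⊤) (g : G) :
    wordNorm S g⁻¹ = wordNorm S g :=
  le_antisymm (wordNorm_inv_le hS g) (by simpa using wordNorm_inv_le hS g⁻¹)

/-- The word metric `dist g h = |g⁻¹ h|_S` of a generating set `S`. -/
@[reducible]
def wordMetricSpace (S : Set G) (hS : Subgroup.closure S = ⊤) : MetricSpace G where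
  dist g h := (wordNorm S (g⁻¹ * h) : ℝ)
  dist_self g := by simp [wordNorm_one]
  dist_comm g h := by
    rw [← wordNorm_inv hS (g⁻¹ * h)]
    simp
  dist_triangle g h k := by
    have := wordNorm_mul_le hS (g⁻¹ * h) (h⁻¹ * k)
    rw [show g⁻¹ * h * (h⁻¹ * k) = g⁻¹ * k by group] at this
    exact_mod_cast this
  eq_of_dist_eq_zero {g h} hd := by
    have h0 : wordNorm S (g⁻¹ * h) = 0 := by exact_mod_cast hd
    exact inv_mul_eq_one.1 (eq_one_of_wordNorm hS h0)

end WordMetric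

/-! ### Asymptotic cones -/

section Cone

variable {X : Type u} [MetricSpace X]

/-- Sequences in `X` at finite `ω`-distance from the observation points `b`, for the metrics
`dist / d i`. -/
def ConeSeq (ω : Ultrafilter ℕ) (b : ℕ → X) (d : ℕ → ℝ≥0) : Type u :=
  {y : ℕ → X // ∃ C : ℝ, ∀ᶠ i in (ω : Filter ℕ), dist (y i) (b i) / d i ≤ C}

variable {ω : Ultrafilter ℕ} {b : ℕ → X} {d : ℕ → ℝ≥0}

/-- The `ω`-limit of the rescaled distances; the limit exists by `ConeSeq.tendsto_dist`. -/
def ConeSeq.limDist (y z : ConeSeq ω b d) : ℝ :=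
  limUnder (ω : Filter ℕ) (fun i => dist (y.1 i) (z.1 i) / d i)

theorem ConeSeq.tendsto_dist (y z : ConeSeq ω b d) :
    Tendsto (fun i => dist (y.1 i) (z.1 i) / d i) (ω : Filter ℕ) (𝓝 (y.limDist z)) := by
  obtain ⟨C, hC⟩ := y.2
  obtain ⟨D, hD⟩ := z.2
  have hmem : ∀ᶠ i in (ω : Filter ℕ), dist (y.1 i) (z.1 i) / d i ∈ Set.Icc 0 (C + D) := by
    filter_upwards [hC, hD] with i h1 h2
    refine ⟨by positivity, ?_⟩
    calc dist (y.1 i) (z.1 i) / d i ≤ (dist (y.1 i) (b i) + dist (z.1 i) (b i)) / d i := by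
          gcongr
          exact dist_triangle_right _ _ _
      _ ≤ C + D := by rw [add_div]; exact add_le_add h1 h2
  obtain ⟨l, -, hl⟩ := (isCompact_Icc (a := (0 : ℝ)) (b := C + D)).ultrafilter_le_nhds
    (ω.map fun i => dist (y.1 i) (z.1 i) / d i) (le_principal_iff.2 hmem)
  exact tendsto_nhds_limUnder ⟨l, hl⟩

instance : PseudoMetricSpace (ConeSeq ω b d) where
  dist y z := y.limDist z
  dist_self y := by
    refine tendsto_nhds_unique (ConeSeq.tendsto_dist y y) ?_
    simp
  dist_comm y z := by
    refine tendsto_nhds_unique (ConeSeq.tendsto_dist y z) ?_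
    simpa only [dist_comm] using ConeSeq.tendsto_dist z y
  dist_triangle x y z := by
    refine le_of_tendsto_of_tendsto' (ConeSeq.tendsto_dist x z)
      ((ConeSeq.tendsto_dist x y).add (ConeSeq.tendsto_dist y z)) fun i => ?_
    rw [← add_div]
    gcongr
    exact dist_triangle _ _ _

/-- The asymptotic cone `Cone_ω(X, b, d)`: sequences at finite `ω`-distance from `b`, modulo
`ω`-distance zero. -/
abbrev AsymptoticCone (ω : Ultrafilter ℕ) (b : ℕ → X) (d : ℕ → ℝ≥0) : Type u :=
  SeparationQuotient (ConeSeq ω b d)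

end Cone

/-- `p` is a (global) cut-point if its complement is not connected. The empty set does not count as
connected, so the point of a singleton is a cut-point. -/
def IsCutPoint {Y : Type u} [TopologicalSpace Y] (p : Y) : Prop :=
  ¬ IsConnected ({p}ᶜ : Set Y)

/-- A metric space satisfies this if, for some non-principal ultrafilter and some sequence of
scaling constants, none of its asymptotic cones (for any observation points) has a cut-point. -/
def HasConesWithoutCutPoints (X : Type u) [MetricSpace X] : Prop :=
  ∃ (ω : Ultrafilter ℕ) (d : ℕ → ℝ≥0),
    (ω : Filter ℕ) ≤ cofinite ∧ (∀ i, 0 < d i) ∧ Tendsto d (ω : Filter ℕ) atTop ∧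
      ∀ b : ℕ → X, ∀ p : AsymptoticCone ω b d, ¬ IsCutPoint p

/-- Every point is at distance at most `c` from a bi-infinite geodesic. The spaces in question are
vertex sets of Cayley graphs, where bi-infinite geodesics are parametrized by the integers. -/
def NearBiinfiniteGeodesics (X : Type u) [MetricSpace X] : Prop :=
  ∃ c : ℝ, ∀ x : X, ∃ γ : ℤ → X, Isometry γ ∧ ∃ k : ℤ, dist x (γ k) ≤ c

/-- A finitely generated group is unconstricted if it is so for a word metric (the choice of the
word metric is immaterial, the notion being a quasi-isometry invariant). -/
def IsUnconstrictedGroup (G : Type u) [Group G] : Prop :=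
  ∃ (S : Set G) (hS : Subgroup.closure S = ⊤), S.Finite ∧
    letI := wordMetricSpace S hS
    HasConesWithoutCutPoints G ∧ NearBiinfiniteGeodesics G

/-! ### Algebraic networks and algebraic thickness -/

section Thick

variable {G : Type u} [Group G]

/-- A finitely generated subgroup `H` of a finitely generated group `G` is undistorted if every word
metric of `H` is bi-Lipschitz equivalent to the restriction of every word metric of `G`. -/
def IsUndistorted (H : Subgroup G) : Prop :=
  ∀ S : Set G, S.Finite → Subgroup.closure S = ⊤ →
    ∀ T : Set H, T.Finite → Subgroup.closure T = ⊤ →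
      ∃ C : ℝ, 0 < C ∧ ∀ h : H,
        (wordNorm T h : ℝ) ≤ C * wordNorm S (h : G) ∧
          (wordNorm S (h : G) : ℝ) ≤ C * wordNorm T h

/-- `H` and `K` can be joined by a finite sequence of members of `𝓗`, consecutive ones having
infinite intersection. -/
def ThicklyConnected (𝓗 : Set (Subgroup G)) (H K : Subgroup G) : Prop :=
  Relation.ReflTransGen
    (fun A B : Subgroup G => A ∈ 𝓗 ∧ B ∈ 𝓗 ∧ ((A ⊓ B : Subgroup G) : Set G).Infinite) H K

/-- `G`, with the word metric of the finite generating set `S`, is an `M`-algebraic network with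
respect to the finite collection `𝓗` of subgroups. (Asking `𝓗` to be non-empty only keeps a finite
group from being a network with respect to the empty collection.) -/
structure IsAlgebraicNetwork (S : Set G) (M : ℝ) (𝓗 : Set (Subgroup G)) : Prop where
  finite_gen : S.Finite
  closure_gen : Subgroup.closure S = ⊤
  pos : 0 < M
  finite : 𝓗.Finite
  nonempty : 𝓗.Nonempty
  undistorted : ∀ H ∈ 𝓗, H.FG ∧ IsUndistorted H
  generates : ∃ G₁ : Subgroup G, G₁.FiniteIndex ∧
    (∀ g : G, ∃ h ∈ G₁, (wordNorm S (g⁻¹ * h) : ℝ) < M) ∧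
    ∃ T : Set G, T.Finite ∧ Subgroup.closure T = G₁ ∧ T ⊆ ⋃ H ∈ 𝓗, (H : Set G)
  connected : ∀ H ∈ 𝓗, ∀ K ∈ 𝓗, ThicklyConnected 𝓗 H K

end Thick

/-- `G` is algebraically thick of order at most `n`. -/
def AlgThickOfOrderAtMost : ℕ → (G : Type u) → [Group G] → Prop
  | 0, G, _ => IsUnconstrictedGroup G
  | n + 1, G, _ => ∃ (S : Set G) (M : ℝ) (𝓗 : Set (Subgroup G)),
      IsAlgebraicNetwork S M 𝓗 ∧ ∀ H ∈ 𝓗, AlgThickOfOrderAtMost n H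

/-- `G`, with the word metric of `S`, is `M`-algebraically thick of order at most `n + 1` with
respect to `𝓗`. -/
def AlgThickSuccWithRespectTo {G : Type u} [Group G] (n : ℕ) (S : Set G) (M : ℝ)
    (𝓗 : Set (Subgroup G)) : Prop :=
  IsAlgebraicNetwork S M 𝓗 ∧ ∀ H ∈ 𝓗, AlgThickOfOrderAtMost n H

/-! ### Automorphisms of free groups -/

section Aut

variable {α : Type u} [DecidableEq α]

/-- The endomorphism `x_a ↦ u x_a v`, fixing the other generators. -/
def transvectionHom (a : α) (u v : FreeGroup α) : FreeGroup α →* FreeGroup α :=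
  FreeGroup.lift fun j => if j = a then u * FreeGroup.of a * v else FreeGroup.of j

theorem transvectionHom_of_self (a : α) (u v : FreeGroup α) :
    transvectionHom a u v (FreeGroup.of a) = u * FreeGroup.of a * v := by
  simp [transvectionHom]

theorem transvectionHom_of_ne {a j : α} (h : j ≠ a) (u v : FreeGroup α) :
    transvectionHom a u v (FreeGroup.of j) = FreeGroup.of j := by
  simp [transvectionHom, h]

theorem transvectionHom_comp {a : α} {u v u' v' : FreeGroup α}
    (hu : transvectionHom a u v u' = u') (hv : transvectionHom a u v v' = v')
    (huu : u' * u = 1) (hvv : v * v' = 1) :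
    (transvectionHom a u v).comp (transvectionHom a u' v') = MonoidHom.id _ := by
  refine FreeGroup.ext_hom _ _ fun j => ?_
  by_cases h : j = a
  · subst h
    simp only [MonoidHom.comp_apply, transvectionHom_of_self, map_mul, hu, hv, MonoidHom.id_apply]
    calc u' * (u * FreeGroup.of j * v) * v' = (u' * u) * FreeGroup.of j * (v * v') := by group
      _ = FreeGroup.of j := by rw [huu, hvv, one_mul, mul_one]
  · simp [MonoidHom.comp_apply, transvectionHom_of_ne h]

/-- For `b ≠ a`: the automorphism `x_a ↦ x_a x_b`, fixing the other generators. -/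
def rightTransvection (a b : α) (h : b ≠ a) : MulAut (FreeGroup α) :=
  MonoidHom.toMulEquiv (transvectionHom a 1 (FreeGroup.of b))
    (transvectionHom a 1 (FreeGroup.of b)⁻¹)
    (transvectionHom_comp (by simp) (by simp [transvectionHom_of_ne h]) (by simp) (by simp))
    (transvectionHom_comp (by simp) (by simp [transvectionHom_of_ne h]) (by simp) (by simp))

/-- For `b ≠ a`: the automorphism `x_a ↦ x_b x_a`, fixing the other generators. -/
def leftTransvection (a b : α) (h : b ≠ a) : MulAut (FreeGroup α) :=
  MonoidHom.toMulEquiv (transvectionHom a (FreeGroup.of b) 1)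
    (transvectionHom a (FreeGroup.of b)⁻¹ 1)
    (transvectionHom_comp (by simp [transvectionHom_of_ne h]) (by simp) (by simp) (by simp))
    (transvectionHom_comp (by simp [transvectionHom_of_ne h]) (by simp) (by simp) (by simp))

end Aut

/-- The group of inner automorphisms. -/
def Inn (G : Type u) [Group G] : Subgroup (MulAut G) := (MulAut.conj : G →* MulAut G).range

instance (G : Type u) [Group G] : (Inn G).Normal where
  conj_mem := by
    rintro _ ⟨g, rfl⟩ φ
    refine ⟨φ g, ?_⟩
    ext x
    simp [MulAut.conj_apply]

/-- The outer automorphism group `Aut(G) / Inn(G)`. -/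
abbrev Out (G : Type u) [Group G] : Type u := MulAut G ⧸ Inn G

/-- The free group of rank `n` (for `n ≥ 1`), its free generators being indexed modulo `n`. -/
abbrev FreeGrp (n : ℕ) : Type := FreeGroup (ZMod n)

section Nielsen

variable {n : ℕ}

theorem ne_add_one_zmod (hn : 3 ≤ n) (i : ZMod n) : i ≠ i + 1 := by
  have : Fact (1 < n) := ⟨by omega⟩
  simp

theorem ne_add_two_zmod (hn : 3 ≤ n) (i : ZMod n) : i ≠ i + 2 := by
  intro h
  have h2 : ((2 : ℕ) : ZMod n) = 0 := by simpa using h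
  rw [ZMod.natCast_eq_zero_iff] at h2
  have := Nat.le_of_dvd (by norm_num) h2
  omega

/-- `r_i : x_{i+1} ↦ x_{i+1} x_i`. -/
def nielsenR (hn : 3 ≤ n) (i : ZMod n) : MulAut (FreeGrp n) :=
  rightTransvection (i + 1) i (ne_add_one_zmod hn i)

/-- `l_i : x_{i+1} ↦ x_i x_{i+1}`. -/
def nielsenL (hn : 3 ≤ n) (i : ZMod n) : MulAut (FreeGrp n) :=
  leftTransvection (i + 1) i (ne_add_one_zmod hn i)

/-- `n_i : x_{i+2} ↦ x_{i+2} x_i`. -/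
def nielsenN (hn : 3 ≤ n) (i : ZMod n) : MulAut (FreeGrp n) :=
  rightTransvection (i + 2) i (ne_add_two_zmod hn i)

/-- The distance of `i` and `j` in the cyclic group `ℤ / n`. -/
def cyclicDist (i j : ZMod n) : ℕ := (i - j).valMinAbs.natAbs

/-- The family of subgroups `⟨φ_i, φ_j⟩` with `φ_i ∈ {r_i, l_i}`, `φ_j ∈ {r_j, l_j}` and
`dist(i, j) ≥ 2`, together with `⟨r_i, l_i⟩`, `⟨n_i, r_i⟩` and `⟨n_i, l_{i+1}⟩`. -/
def nielsenFamily (hn : 3 ≤ n) : Set (Subgroup (MulAut (FreeGrp n))) :=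
  {H | ∃ i j : ZMod n, 2 ≤ cyclicDist i j ∧
      ∃ φ ∈ ({nielsenR hn i, nielsenL hn i} : Set (MulAut (FreeGrp n))),
      ∃ ψ ∈ ({nielsenR hn j, nielsenL hn j} : Set (MulAut (FreeGrp n))),
        H = Subgroup.closure {φ, ψ}} ∪
  {H | ∃ i : ZMod n, H = Subgroup.closure {nielsenR hn i, nielsenL hn i}} ∪
  {H | ∃ i : ZMod n, H = Subgroup.closure {nielsenN hn i, nielsenR hn i}} ∪
  {H | ∃ i : ZMod n, H = Subgroup.closure {nielsenN hn i, nielsenL hn (i + 1)}}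

/-- The images in `Out(F_n)` of the members of `nielsenFamily`. -/
def outNielsenFamily (hn : 3 ≤ n) : Set (Subgroup (Out (FreeGrp n))) :=
  Subgroup.map (QuotientGroup.mk' (Inn (FreeGrp n))) '' nielsenFamily hn

end Nielsen

end

/-! Thickness is reduced in `algThick_of_pairs` to three facts about the generating pairs of the
family: each pair is an undistorted commuting pair, any two pairs are joined by a chain in which
neighbours share an element, and every group element is a product of an element generated by members
of the pairs and one of finitely many others.

Finite index is Nielsen reduction (`exists_mul_mem_signedPerms`). In a coset of the subgroup
generated by the elementary moves, a basis of minimal complexity is Nielsen reduced. Such a basis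
does not shorten reduced words, so the inverse automorphism sends generators to generators or their
inverses. Commutators of the `r_i` and `l_i` supply all elementary moves
(`exists_isElementaryMove`).

Undistortion is proved in the outer automorphism group and pulled back to the automorphism group,
since word norms do not grow under a surjection (`IsUndistortedPair.of_map`). By
`bounded_cancellation`, an automorphism lowers the exponent of a power occurring in a reduced word
by at most a constant (`HasPower.apply`). A short test word is chosen whose image under `φ ^ a * ψ ^
b` is conjugate to a cyclically reduced word containing an `|a|`-th and a `|b|`-th power of letters.
Half of such a power survives every conjugation (`hasPower_conj`), so conjugacy ambiguity is
harmless. Undoing the outer class with a word of length `N` returns the test word while losing only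
`O(N)` from the exponent, whence `|a| + |b| = O(N + 1)` (`exists_power_le_wordNorm`). This growth
also gives injectivity of `(a, b) ↦ φ ^ a * ψ ^ b`, so the members are free abelian of rank two.

Such a group is unconstricted because its asymptotic cones are planes with the `ℓ¹` metric
(`not_isCutPoint_of_lattice`). Connectivity comes from the links `⟨r_i, l_i⟩`, `⟨n_i, r_i⟩`, `⟨n_i,
l_{i+1}⟩`, `⟨r_{i+1}, l_{i+1}⟩` (`reflTransGen_rl_zero`). -/

/-! ### Common prefixes in free groups -/

namespace FreeGroup

section Prefix

variable {α : Type*}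

/-- The inverse of a letter. -/
def invLetter (l : α × Bool) : α × Bool := (l.1, !l.2)

@[simp]
theorem invLetter_fst (l : α × Bool) : (invLetter l).1 = l.1 := rfl

@[simp]
theorem invLetter_invLetter (l : α × Bool) : invLetter (invLetter l) = l := by
  simp [invLetter]

theorem invLetter_ne (l : α × Bool) : invLetter l ≠ l := by
  rcases l with ⟨i, _ | _⟩ <;> simp [invLetter]

theorem invRev_cons' (l : α × Bool) (w : List (α × Bool)) :
    invRev (l :: w) = invRev w ++ [invLetter l] := by
  simp [invRev, invLetter]

theorem mk_invLetter (l : α × Bool) : mk [invLetter l] = (mk [l])⁻¹ := by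
  simp [inv_mk, invRev, invLetter]

theorem eq_or_eq_invLetter {a b : α × Bool} (h : a.1 = b.1) : a = b ∨ a = invLetter b := by
  rcases a with ⟨i, _ | _⟩ <;> rcases b with ⟨j, _ | _⟩ <;> simp_all [invLetter]

theorem isReduced_invRev {w : List (α × Bool)} (h : IsReduced w) : IsReduced (invRev w) := by
  classical
  rw [isReduced_iff_reduce_eq] at h ⊢
  rw [reduce_invRev, h]

theorem isReduced_append_iff {v w : List (α × Bool)} :
    IsReduced (v ++ w) ↔ IsReduced v ∧ IsReduced w ∧
      ∀ a ∈ v.getLast?, ∀ b ∈ w.head?, a.1 = b.1 → a.2 = b.2 := by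
  simp only [IsReduced]
  exact List.isChain_append

theorem IsReduced.of_isInfix {v w : List (α × Bool)} (h : IsReduced w) (hv : v <:+: w) :
    IsReduced v := by
  obtain ⟨s, t, rfl⟩ := hv
  rw [isReduced_append_iff, isReduced_append_iff] at h
  exact h.1.2.1

/-- Once the longest common prefix is stripped, the remainders begin with different letters, so
nothing cancels where they meet. -/
theorem exists_append_isReduced {v w : List (α × Bool)} (hv : IsReduced v) (hw : IsReduced w) :
    ∃ p s t, v = p ++ s ∧ w = p ++ t ∧ IsReduced (invRev s ++ t) := by
  classical
  induction v generalizing w with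
  | nil => exact ⟨[], [], w, by simp, by simp, by simpa using hw⟩
  | cons a v ih =>
    rcases w with _ | ⟨b, w⟩
    · exact ⟨[], a :: v, [], by simp, by simp, by simpa using isReduced_invRev hv⟩
    by_cases hab : a = b
    · subst hab
      obtain ⟨p, s, t, rfl, rfl, h⟩ :=
        ih (w := w) (hv.of_isInfix ⟨[a], [], by simp⟩) (hw.of_isInfix ⟨[a], [], by simp⟩)
      exact ⟨a :: p, s, t, by simp, by simp, h⟩
    · refine ⟨[], a :: v, b :: w, by simp, by simp, ?_⟩
      rw [isReduced_append_iff]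
      refine ⟨isReduced_invRev hv, hw, ?_⟩
      intro x hx y hy
      rw [invRev_cons'] at hx
      simp only [List.getLast?_append, List.getLast?_singleton, Option.some_or,
        Option.mem_some_iff, List.head?_cons] at hx hy
      subst hx hy
      intro h
      by_contra h'
      apply hab
      rcases a with ⟨i, _ | _⟩ <;> rcases b with ⟨j, _ | _⟩ <;> simp_all [invLetter]

variable [DecidableEq α]

/-- The length of the longest common prefix of two reduced words, that is, the Gromov product at
`1` in the Cayley tree. -/
def gromov (u v : FreeGroup α) : ℕ := (norm u + norm v - norm (u⁻¹ * v)) / 2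

theorem toWord_mk_of_isReduced {w : List (α × Bool)} (h : IsReduced w) : (mk w).toWord = w := by
  rw [toWord_mk, h.reduce_eq]

theorem norm_mk_of_isReduced {w : List (α × Bool)} (h : IsReduced w) : norm (mk w) = w.length := by
  rw [norm, toWord_mk_of_isReduced h]

/-- The numerator in `gromov` is twice the length of the common prefix, so the natural-number
subtraction and division there lose nothing. -/
theorem gromov_spec (u v : FreeGroup α) :
    ∃ p s t, u.toWord = p ++ s ∧ v.toWord = p ++ t ∧ (u⁻¹ * v).toWord = invRev s ++ t ∧
      p.length = gromov u v := by
  obtain ⟨p, s, t, hu, hv, h⟩ := exists_append_isReduced (isReduced_toWord (x := u))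
    (isReduced_toWord (x := v))
  have huv : (u⁻¹ * v).toWord = invRev s ++ t := by
    rw [← toWord_mk_of_isReduced h, toWord_inj, ← mk_toWord (x := u), ← mk_toWord (x := v), hu, hv,
      ← mul_mk, ← mul_mk, ← mul_mk, ← inv_mk]
    group
  refine ⟨p, s, t, hu, hv, huv, ?_⟩
  simp only [gromov, norm, hu, hv, huv, List.length_append, invRev_length]
  omega

theorem norm_inv_mul (u v : FreeGroup α) :
    norm (u⁻¹ * v) + 2 * gromov u v = norm u + norm v := by
  obtain ⟨p, s, t, hu, hv, huv, hp⟩ := gromov_spec u v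
  simp only [← hp, norm, hu, hv, huv, List.length_append, invRev_length]
  omega

theorem gromov_comm (u v : FreeGroup α) : gromov u v = gromov v u := by
  have h1 := norm_inv_mul u v
  have h2 := norm_inv_mul v u
  rw [← norm_inv_eq, mul_inv_rev, inv_inv] at h2
  omega

theorem gromov_le_left (u v : FreeGroup α) : gromov u v ≤ norm u := by
  obtain ⟨p, s, t, hu, hv, huv, hp⟩ := gromov_spec u v
  simp [← hp, norm, hu]

theorem gromov_le_right (u v : FreeGroup α) : gromov u v ≤ norm v := by
  rw [gromov_comm]
  exact gromov_le_left v u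

theorem le_gromov_iff {u v : FreeGroup α} {m : ℕ} :
    m ≤ gromov u v ↔ m ≤ norm u ∧ m ≤ norm v ∧ u.toWord.take m = v.toWord.take m := by
  obtain ⟨p, s, t, hu, hv, huv, hp⟩ := gromov_spec u v
  constructor
  · intro h
    refine ⟨h.trans (gromov_le_left u v), h.trans (gromov_le_right u v), ?_⟩
    rw [hu, hv, List.take_append_of_le_length (by omega), List.take_append_of_le_length (by omega)]
  · rintro ⟨h1, h2, h3⟩
    by_contra! hm
    rw [← hp] at hm
    simp only [norm, hu, hv, List.length_append] at h1 h2 h3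
    rw [List.take_append, List.take_append, List.take_of_length_le hm.le,
      List.append_cancel_left_eq] at h3
    -- If agreement went beyond `p`, then `s` and `t` would start with the same letter, and `invRev
    -- s ++ t` would not be reduced.
    rcases s with _ | ⟨a, s⟩
    · simp at h1; omega
    rcases t with _ | ⟨b, t⟩
    · simp at h2; omega
    obtain ⟨k, hk⟩ : ∃ k, m - p.length = k + 1 := ⟨m - p.length - 1, by omega⟩
    rw [hk, List.take_succ_cons, List.take_succ_cons, List.cons.injEq] at h3
    have hr : IsReduced (invRev (a :: s) ++ b :: t) := huv ▸ isReduced_toWord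
    rw [isReduced_append_iff, invRev_cons'] at hr
    have := hr.2.2 (invLetter a) (by simp) b (by simp)
    rw [h3.1] at this
    simp [invLetter] at this

theorem gromov_self (u : FreeGroup α) : gromov u u = norm u :=
  le_antisymm (gromov_le_left u u) (le_gromov_iff.2 (by simp))

/-- The Cayley tree is `0`-hyperbolic. The cancellation estimates below are linear arithmetic over
this inequality and `norm_inv_mul`. -/
theorem min_gromov_le (u v w : FreeGroup α) : min (gromov u v) (gromov v w) ≤ gromov u w := by
  obtain ⟨h1, h2, h3⟩ := le_gromov_iff.1 (min_le_left (gromov u v) (gromov v w))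
  obtain ⟨h4, h5, h6⟩ := le_gromov_iff.1 (min_le_right (gromov u v) (gromov v w))
  exact le_gromov_iff.2 ⟨h1, h5, h3.trans h6⟩

theorem toWord_eq_conj (g : FreeGroup α) : g.toWord = reduceCyclically.conjugator g.toWord ++
    reduceCyclically g.toWord ++ invRev (reduceCyclically.conjugator g.toWord) :=
  (reduceCyclically.conj_conjugator_reduceCyclically _).symm

theorem toWord_pow_succ (g : FreeGroup α) (k : ℕ) : (g ^ (k + 1)).toWord =
    reduceCyclically.conjugator g.toWord ++
      (List.replicate (k + 1) (reduceCyclically g.toWord)).flatten ++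
        invRev (reduceCyclically.conjugator g.toWord) := by
  rw [toWord_pow, reduceCyclically.reduce_flatten_replicate_succ isReduced_toWord]

theorem reduceCyclically_ne_nil {g : FreeGroup α} (hg : g ≠ 1) :
    reduceCyclically g.toWord ≠ [] := by
  intro h
  apply hg
  have := toWord_eq_conj g
  rw [h, List.append_nil] at this
  rw [← mk_toWord (x := g), this, ← mul_mk, ← inv_mk, mul_inv_cancel]

/-- Writing `g = c z c⁻¹` with `z` cyclically reduced and non-empty, exactly `|c|` letters cancel in
`g * g`, while `|g| = 2|c| + |z|`. -/
theorem two_mul_gromov_inv_lt {g : FreeGroup α} (hg : g ≠ 1) : 2 * gromov g⁻¹ g < norm g := by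
  have h := norm_inv_mul g⁻¹ g
  have h2 := congrArg List.length (toWord_pow_succ g 1)
  have h1 := congrArg List.length (toWord_eq_conj g)
  have h0 := List.length_pos_of_ne_nil (reduceCyclically_ne_nil hg)
  rw [inv_inv, norm_inv_eq, ← pow_two] at h
  simp only [List.length_append, invRev_length, List.length_flatten, List.map_replicate,
    List.sum_replicate, smul_eq_mul] at h1 h2
  simp only [norm] at h ⊢
  simp only [Nat.reduceAdd] at h2
  omega

end Prefix

end FreeGroup

/-! ### Nielsen reduction -/

namespace FreeGroup

section NielsenReduced

variable {α : Type*} [DecidableEq α]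

/-- The images under `φ` of the free generators form a Nielsen reduced basis. -/
structure IsNielsenReduced (φ : MulAut (FreeGroup α)) : Prop where
  intro ::
  -- In a product of two images at most half of each factor cancels; in a product of three, some of
  -- the middle factor is left.
  two_mul_gromov_le : ∀ a b : α × Bool, a ≠ b →
    2 * gromov (φ (mk [a])) (φ (mk [b])) ≤ norm (φ (mk [a]))
  gromov_add_lt : ∀ a v b : α × Bool, a ≠ v → b ≠ invLetter v →
    gromov (φ (mk [a])) (φ (mk [v])) + gromov (φ (mk [invLetter v])) (φ (mk [b])) <
      norm (φ (mk [v]))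

theorem mk_singleton_ne_one (l : α × Bool) : mk [l] ≠ 1 := by
  intro h
  have := congrArg toWord h
  rw [toWord_mk_of_isReduced IsReduced.singleton, toWord_one] at this
  simp at this

theorem apply_mk_singleton_ne_one (φ : MulAut (FreeGroup α)) (l : α × Bool) : φ (mk [l]) ≠ 1 := by
  rw [Ne, EmbeddingLike.map_eq_one_iff]
  exact mk_singleton_ne_one l

theorem norm_apply_mk_singleton_pos (φ : MulAut (FreeGroup α)) (l : α × Bool) :
    0 < norm (φ (mk [l])) := by
  rw [Nat.pos_iff_ne_zero, Ne, norm_eq_zero]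
  exact apply_mk_singleton_ne_one φ l

/-- The number `c` counts the letters of the first factor that cancel against the second. For the
induction it must be known that the rest of the first factor is still a prefix of the whole image,
besides the bound on the length. -/
theorem IsNielsenReduced.norm_apply_cons {φ : MulAut (FreeGroup α)} (h : IsNielsenReduced φ)
    (w : List (α × Bool)) (l : α × Bool) (hw : IsReduced (l :: w)) :
    ∃ c, (c = 0 ∨ ∃ b, b ≠ invLetter l ∧ c = gromov (φ (mk [invLetter l])) (φ (mk [b]))) ∧
      norm (φ (mk [l])) ≤ gromov (φ (mk (l :: w))) (φ (mk [l])) + c ∧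
      w.length + norm (φ (mk [l])) ≤ norm (φ (mk (l :: w))) + c := by
  induction w generalizing l with
  | nil => exact ⟨0, Or.inl rfl, by simp [gromov_self], by simp⟩
  | cons m w ih =>
    rw [isReduced_cons_cons] at hw
    obtain ⟨c, hc, h1, h2⟩ := ih m hw.2
    have hne : invLetter l ≠ m := by
      rintro rfl
      simp [invLetter] at hw
    set d := gromov (φ (mk [invLetter l])) (φ (mk [m])) with hd
    have hdc : d + c < norm (φ (mk [m])) := by
      rcases hc with rfl | ⟨b, hb, rfl⟩
      · have := h.two_mul_gromov_le m (invLetter l) hne.symm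
        have := norm_apply_mk_singleton_pos φ m
        rw [hd, gromov_comm]
        omega
      · exact h.gromov_add_lt _ _ _ hne hb
    -- Since `d + c` is less than the length of the image of `m`, more than `d` of its letters
    -- survive as a prefix of the image of `m :: w`. Hence exactly `d` letters cancel against the
    -- image of `l`.
    have h3 := min_gromov_le (φ (mk [invLetter l])) (φ (mk (m :: w))) (φ (mk [m]))
    have h4 := min_gromov_le (φ (mk [invLetter l])) (φ (mk [m])) (φ (mk (m :: w)))
    rw [gromov_comm (φ (mk [m]))] at h4
    have hQ : φ (mk (l :: m :: w)) = (φ (mk [invLetter l]))⁻¹ * φ (mk (m :: w)) := by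
      rw [mk_invLetter, _root_.map_inv, inv_inv, ← _root_.map_mul, mul_mk]
      rfl
    have h5 := norm_inv_mul (φ (mk [invLetter l])) (φ (mk (m :: w)))
    rw [← hQ] at h5
    have h6 := norm_inv_mul (φ (mk (l :: m :: w))) (φ (mk [l]))
    have h7 : norm ((φ (mk (l :: m :: w)))⁻¹ * φ (mk [l])) = norm (φ (mk (m :: w))) := by
      rw [hQ, mk_invLetter, _root_.map_inv, ← norm_inv_eq]
      simp
    have h8 : norm (φ (mk [invLetter l])) = norm (φ (mk [l])) := by
      rw [mk_invLetter, _root_.map_inv, norm_inv_eq]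
    refine ⟨d, Or.inr ⟨m, hne.symm, hd⟩, ?_, ?_⟩
    · omega
    · rw [List.length_cons]
      omega

theorem IsNielsenReduced.length_le_norm {φ : MulAut (FreeGroup α)} (h : IsNielsenReduced φ)
    {w : List (α × Bool)} (hw : IsReduced w) : w.length ≤ norm (φ (mk w)) := by
  rcases w with _ | ⟨l, w⟩
  · simp
  obtain ⟨c, hc, -, h2⟩ := h.norm_apply_cons w l hw
  have hpos := norm_apply_mk_singleton_pos φ l
  have h8 : norm (φ (mk [invLetter l])) = norm (φ (mk [l])) := by
    rw [mk_invLetter, _root_.map_inv, norm_inv_eq]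
  have hlt : c < norm (φ (mk [l])) := by
    rcases hc with rfl | ⟨b, hb, rfl⟩
    · exact hpos
    · have := h.two_mul_gromov_le _ _ hb.symm
      omega
  rw [List.length_cons]
  omega

/-- The automorphisms that map each free generator to a free generator or its inverse. -/
def signedPerms (α : Type*) : Set (MulAut (FreeGroup α)) :=
  {φ | ∀ i, ∃ l : α × Bool, φ (of i) = mk [l]}

theorem finite_signedPerms (α : Type*) [Finite α] : (signedPerms α).Finite := by
  classical
  refine Set.Finite.of_finite_image (f := fun φ : MulAut (FreeGroup α) => fun i => φ (of i)) ?_ ?_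
  · refine (Set.finite_range fun f : α → α × Bool => fun i => mk [f i]).subset ?_
    rintro _ ⟨φ, hφ, rfl⟩
    choose f hf using hφ
    exact ⟨f, funext fun i => (hf i).symm⟩
  · intro φ _ ψ _ h
    apply MulEquiv.toMonoidHom_injective
    ext i
    exact congrFun h i

/-- The preimage of a free generator is no longer than the generator itself, so it is a single
letter. -/
theorem IsNielsenReduced.inv_mem_signedPerms {φ : MulAut (FreeGroup α)} (h : IsNielsenReduced φ) :
    φ⁻¹ ∈ signedPerms α := by
  intro i
  set g := φ⁻¹ (of i) with hg
  have hφ : φ g = of i := by simp [hg]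
  have h1 := h.length_le_norm (isReduced_toWord (x := g))
  rw [mk_toWord, hφ, norm_of] at h1
  have h0 : g.toWord ≠ [] := by
    rw [Ne, toWord_eq_nil_iff]
    rintro h0
    rw [h0, _root_.map_one] at hφ
    exact of_ne_one i hφ.symm
  have h0' := List.length_pos_of_ne_nil h0
  obtain ⟨l, hl⟩ := List.length_eq_one_iff.1 (le_antisymm h1 h0')
  exact ⟨l, by rw [← hl, mk_toWord]⟩

end NielsenReduced

/-! ### Minimal complexity and Nielsen's theorem -/

section Reduction

variable {α : Type*}

/-- The letter `a` is replaced by `v⁻¹ a`, where `v` is a letter other than `a` and `a⁻¹`. -/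
def IsElementaryMove (τ : MulAut (FreeGroup α)) (a v : α × Bool) : Prop :=
  τ (mk [a]) = (mk [v])⁻¹ * mk [a] ∧ ∀ i, i ≠ a.1 → τ (of i) = of i

theorem mk_singleton (l : α × Bool) : mk [l] = if l.2 then of l.1 else (of l.1)⁻¹ := by
  rcases l with ⟨i, _ | _⟩ <;> simp [of, inv_mk, invRev]

theorem IsElementaryMove.apply_of_ne {τ : MulAut (FreeGroup α)} {a v l : α × Bool}
    (h : IsElementaryMove τ a v) (hl : l.1 ≠ a.1) : τ (mk [l]) = mk [l] := by
  rw [mk_singleton]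
  split_ifs <;> simp [h.2 _ hl]

theorem IsElementaryMove.apply_inv {τ : MulAut (FreeGroup α)} {a v : α × Bool}
    (h : IsElementaryMove τ a v) : τ (mk [invLetter a]) = ((mk [v])⁻¹ * mk [a])⁻¹ := by
  rw [mk_invLetter, _root_.map_inv, h.1]

variable [Fintype α]

/-- A numbering of words, injective on the words of a given length. -/
noncomputable def wordCode (w : List (α × Bool)) : ℕ :=
  -- The base exceeds every digit, and it exceeds `1` even for an empty alphabet.
  Nat.ofDigits (Fintype.card (α × Bool) + 2)
    (w.map fun l => (Fintype.equivFin (α × Bool) l : ℕ))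

theorem wordCode_append (v w : List (α × Bool)) : wordCode (v ++ w) =
    wordCode v + (Fintype.card (α × Bool) + 2) ^ v.length * wordCode w := by
  simp [wordCode, Nat.ofDigits_append]

theorem wordCode_inj {v w : List (α × Bool)} (hl : v.length = w.length)
    (h : wordCode v = wordCode w) : v = w := by
  have key := Nat.ofDigits_inj_of_len_eq (b := Fintype.card (α × Bool) + 2) (by omega)
    (by simpa using hl) ?_ ?_ h
  · refine List.map_injective_iff.2 ?_ key
    exact fun x y hxy => (Fintype.equivFin _).injective (Fin.ext hxy)
  all_goals
    intro d hd
    obtain ⟨l, -, rfl⟩ := List.mem_map.1 hd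
    have := (Fintype.equivFin (α × Bool) l).2
    omega

variable [DecidableEq α]

theorem sum_letters_eq {M : Type*} [AddCommMonoid M] (f : α × Bool → M) (a : α × Bool) :
    ∑ l, f l = f a + f (invLetter a) +
      ∑ l ∈ Finset.univ.filter (fun l : α × Bool => l.1 ≠ a.1), f l := by
  rw [← Finset.sum_filter_add_sum_filter_not Finset.univ (fun l : α × Bool => l.1 = a.1)]
  congr 1
  have : Finset.univ.filter (fun l : α × Bool => l.1 = a.1) = {a, invLetter a} := by
    ext l
    simp only [Finset.mem_filter, Finset.mem_univ, true_and, Finset.mem_insert,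
      Finset.mem_singleton]
    constructor
    · exact eq_or_eq_invLetter
    · rintro (rfl | rfl) <;> rfl
  rw [this, Finset.sum_pair (invLetter_ne a).symm]

/-- The first half of a reduced word. -/
def halfWord (u : FreeGroup α) : List (α × Bool) := u.toWord.take (norm u / 2)

/-- The complexity of a basis: total length, then total code of the initial halves. -/
noncomputable def complexity (φ : MulAut (FreeGroup α)) : ℕ ×ₗ ℕ :=
  toLex (∑ l : α × Bool, norm (φ (mk [l])), ∑ l : α × Bool, wordCode (halfWord (φ (mk [l]))))

theorem complexity_lt_of_norm_lt {φ τ : MulAut (FreeGroup α)} {a v : α × Bool}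
    (hτ : IsElementaryMove τ a v)
    (h : norm ((φ (mk [v]))⁻¹ * φ (mk [a])) < norm (φ (mk [a]))) :
    complexity (φ * τ) < complexity φ := by
  rw [complexity, complexity, Prod.Lex.toLex_lt_toLex]
  left
  dsimp only
  rw [sum_letters_eq _ a, sum_letters_eq (fun l => norm (φ (mk [l]))) a]
  have h3 : ∑ l ∈ Finset.univ.filter (fun l : α × Bool => l.1 ≠ a.1), norm ((φ * τ) (mk [l])) =
      ∑ l ∈ Finset.univ.filter (fun l : α × Bool => l.1 ≠ a.1), norm (φ (mk [l])) := by
    refine Finset.sum_congr rfl fun l hl => ?_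
    rw [MulAut.mul_apply, hτ.apply_of_ne (Finset.mem_filter.1 hl).2]
  rw [h3, MulAut.mul_apply, MulAut.mul_apply, hτ.1, hτ.apply_inv, mk_invLetter]
  simp only [_root_.map_inv, _root_.map_mul, norm_inv_eq]
  omega

/-- The changed prefix lies within the first half of the word because it is no longer than `t`. For
the same reason it does not reach the first half of the inverse, so only one summand of the second
component changes. -/
theorem complexity_lt_of_wordCode_lt {φ τ : MulAut (FreeGroup α)} {a v : α × Bool}
    (hτ : IsElementaryMove τ a v) {p q t : List (α × Bool)} (hpq : p.length = q.length)
    (hpt : p.length ≤ t.length) (ha : (φ (mk [a])).toWord = p ++ t)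
    (hva : ((φ (mk [v]))⁻¹ * φ (mk [a])).toWord = q ++ t) (hlt : wordCode q < wordCode p) :
    complexity (φ * τ) < complexity φ := by
  have hn : norm ((φ (mk [v]))⁻¹ * φ (mk [a])) = norm (φ (mk [a])) := by
    simp [norm, ha, hva, hpq]
  rw [complexity, complexity, Prod.Lex.toLex_lt_toLex]
  right
  dsimp only
  simp only [sum_letters_eq _ a]
  have h3 : ∀ f : FreeGroup α → ℕ,
      ∑ l ∈ Finset.univ.filter (fun l : α × Bool => l.1 ≠ a.1), f ((φ * τ) (mk [l])) =
      ∑ l ∈ Finset.univ.filter (fun l : α × Bool => l.1 ≠ a.1), f (φ (mk [l])) := by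
    refine fun f => Finset.sum_congr rfl fun l hl => ?_
    rw [MulAut.mul_apply, hτ.apply_of_ne (Finset.mem_filter.1 hl).2]
  rw [h3 norm, h3 fun u => wordCode (halfWord u), MulAut.mul_apply, MulAut.mul_apply, hτ.1,
    hτ.apply_inv, mk_invLetter]
  simp only [_root_.map_inv, _root_.map_mul, norm_inv_eq, hn, true_and]
  have hL : norm (φ (mk [a])) = p.length + t.length := by simp [norm, ha]
  have e1 : halfWord ((φ (mk [v]))⁻¹ * φ (mk [a])) =
      q ++ t.take (norm (φ (mk [a])) / 2 - q.length) := by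
    rw [halfWord, hn, hva, List.take_append, List.take_of_length_le (by omega)]
  have e2 : halfWord (φ (mk [a])) = p ++ t.take (norm (φ (mk [a])) / 2 - q.length) := by
    rw [halfWord, ha, List.take_append, List.take_of_length_le (by omega), hpq]
  have e3 : halfWord ((φ (mk [v]))⁻¹ * φ (mk [a]))⁻¹ = halfWord (φ (mk [a]))⁻¹ := by
    rw [halfWord, halfWord, norm_inv_eq, norm_inv_eq, hn, toWord_inv, toWord_inv, hva, ha,
      invRev_append, invRev_append, List.take_append_of_le_length (by rw [invRev_length]; omega),
      List.take_append_of_le_length (by rw [invRev_length]; omega)]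
  rw [e1, e2, e3, wordCode_append, wordCode_append, hpq]
  omega

/-- If more than half of the image of `b` cancelled, replacing `a` by `b⁻¹ a` would shorten the
basis. For `a = b⁻¹` no move is available, and `two_mul_gromov_inv_lt` is used instead. -/
theorem two_mul_gromov_le_of_minimal {φ : MulAut (FreeGroup α)}
    {G₁ : Subgroup (MulAut (FreeGroup α))}
    (hG : ∀ a v : α × Bool, a.1 ≠ v.1 → ∃ τ ∈ G₁, IsElementaryMove τ a v)
    (hmin : ∀ τ ∈ G₁, ¬ complexity (φ * τ) < complexity φ) {a b : α × Bool} (hab : a ≠ b) :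
    2 * gromov (φ (mk [a])) (φ (mk [b])) ≤ norm (φ (mk [b])) := by
  by_cases h1 : a.1 = b.1
  · obtain rfl := (eq_or_eq_invLetter h1).resolve_left hab
    rw [mk_invLetter, _root_.map_inv]
    exact (two_mul_gromov_inv_lt (apply_mk_singleton_ne_one φ b)).le
  by_contra! hlt
  obtain ⟨τ, hτ, hm⟩ := hG a b h1
  refine hmin τ hτ (complexity_lt_of_norm_lt hm ?_)
  have := norm_inv_mul (φ (mk [b])) (φ (mk [a]))
  rw [gromov_comm] at hlt
  omega

/-- When exactly half of the image `p s` of `v` cancels against the image `p t` of `a`, the move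
keeps lengths and replaces the prefix `p` by `s⁻¹`. These are the initial halves of the image of `v`
and of its inverse, so minimality compares their codes. -/
theorem not_wordCode_lt_of_minimal {φ : MulAut (FreeGroup α)}
    {G₁ : Subgroup (MulAut (FreeGroup α))}
    (hG : ∀ a v : α × Bool, a.1 ≠ v.1 → ∃ τ ∈ G₁, IsElementaryMove τ a v)
    (hmin : ∀ τ ∈ G₁, ¬ complexity (φ * τ) < complexity φ) {a v : α × Bool} (hav : a ≠ v)
    (h : 2 * gromov (φ (mk [a])) (φ (mk [v])) = norm (φ (mk [v]))) :
    ¬ wordCode (halfWord (φ (mk [v]))⁻¹) < wordCode (halfWord (φ (mk [v]))) := by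
  intro hlt
  have h1 : a.1 ≠ v.1 := by
    intro h1
    obtain rfl := (eq_or_eq_invLetter h1).resolve_left hav
    rw [mk_invLetter, _root_.map_inv] at h
    exact (two_mul_gromov_inv_lt (apply_mk_singleton_ne_one φ v)).ne h
  have ha := two_mul_gromov_le_of_minimal hG hmin hav.symm
  rw [gromov_comm] at h
  obtain ⟨τ, hτ, hm⟩ := hG a v h1
  obtain ⟨p, s, t, hp, ht, hst, hl⟩ := gromov_spec (φ (mk [v])) (φ (mk [a]))
  have hv : norm (φ (mk [v])) = p.length + s.length := by simp [norm, hp]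
  have ha' : norm (φ (mk [a])) = p.length + t.length := by simp [norm, ht]
  have e1 : halfWord (φ (mk [v])) = p := by
    rw [halfWord, hp, List.take_append_of_le_length (by omega), List.take_of_length_le (by omega)]
  have e2 : halfWord (φ (mk [v]))⁻¹ = invRev s := by
    rw [halfWord, norm_inv_eq, toWord_inv, hp, invRev_append,
      List.take_append_of_le_length (by rw [invRev_length]; omega),
      List.take_of_length_le (by rw [invRev_length]; omega)]
  rw [e1, e2] at hlt
  exact hmin τ hτ (complexity_lt_of_wordCode_lt hm (by rw [invRev_length]; omega) (by omega) ht hst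
    hlt)

theorem isNielsenReduced_of_minimal {φ : MulAut (FreeGroup α)}
    {G₁ : Subgroup (MulAut (FreeGroup α))}
    (hG : ∀ a v : α × Bool, a.1 ≠ v.1 → ∃ τ ∈ G₁, IsElementaryMove τ a v)
    (hmin : ∀ τ ∈ G₁, ¬ complexity (φ * τ) < complexity φ) : IsNielsenReduced φ where
  two_mul_gromov_le a b hab := by
    rw [gromov_comm]
    exact two_mul_gromov_le_of_minimal hG hmin hab.symm
  gromov_add_lt a v b hav hbv := by
    by_contra! hle
    have h1 := two_mul_gromov_le_of_minimal hG hmin hav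
    have h2 := two_mul_gromov_le_of_minimal hG hmin hbv
    have h3 : norm (φ (mk [invLetter v])) = norm (φ (mk [v])) := by
      rw [mk_invLetter, _root_.map_inv, norm_inv_eq]
    rw [gromov_comm (φ (mk [invLetter v]))] at hle
    have n1 := not_wordCode_lt_of_minimal hG hmin hav (by omega)
    have n2 := not_wordCode_lt_of_minimal hG hmin hbv (by omega)
    rw [mk_invLetter, _root_.map_inv, inv_inv] at n2
    have hlen : (halfWord (φ (mk [v]))⁻¹).length = (halfWord (φ (mk [v]))).length := by
      simp [halfWord, norm]
    -- If the middle factor were used up, exactly half of it would cancel on each side. The two code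
    -- comparisons then force its initial half to equal that of its inverse, against
    -- `two_mul_gromov_inv_lt`.
    have heq := wordCode_inj hlen (le_antisymm (not_lt.1 n2) (not_lt.1 n1))
    have h4 : norm (φ (mk [v])) / 2 ≤ gromov (φ (mk [v]))⁻¹ (φ (mk [v])) := by
      refine le_gromov_iff.2 ⟨by rw [norm_inv_eq]; omega, by omega, ?_⟩
      rwa [halfWord, halfWord, norm_inv_eq] at heq
    have h5 := two_mul_gromov_inv_lt (apply_mk_singleton_ne_one φ v)
    omega

/-- Nielsen's theorem: up to automorphisms that permute the free generators and their inverses, each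
automorphism is a product of elementary moves. -/
theorem exists_mul_mem_signedPerms {G₁ : Subgroup (MulAut (FreeGroup α))}
    (hG : ∀ a v : α × Bool, a.1 ≠ v.1 → ∃ τ ∈ G₁, IsElementaryMove τ a v)
    (φ : MulAut (FreeGroup α)) : ∃ τ ∈ G₁, ∃ σ ∈ signedPerms α, φ = τ * σ := by
  -- Minimizing over the coset `φ⁻¹ G₁` makes `φ⁻¹ τ` reduced; the signed permutation is its inverse
  -- `τ⁻¹ φ`.
  obtain ⟨ψ, ⟨τ, hτ, rfl⟩, hmin⟩ := (InvImage.wf complexity wellFounded_lt).has_min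
    {ψ | ∃ τ ∈ G₁, ψ = φ⁻¹ * τ} ⟨φ⁻¹, 1, G₁.one_mem, by simp⟩
  have hr : IsNielsenReduced (φ⁻¹ * τ) := isNielsenReduced_of_minimal hG fun τ' hτ' =>
    hmin _ ⟨τ * τ', G₁.mul_mem hτ hτ', by rw [mul_assoc]⟩
  exact ⟨τ, hτ, _, hr.inv_mem_signedPerms, by group⟩

end Reduction

end FreeGroup

/-! ### Bounded cancellation and powers in words -/

namespace FreeGroup

section Cancellation

variable {α : Type*} [DecidableEq α]

/-- The images of successive prefixes of `v` move in the tree by steps of length at most `L`. The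
first to share `m` letters with the whole image overshoots by at most one step. -/
theorem exists_take_le_gromov {φ : MulAut (FreeGroup α)} {L : ℕ}
    (hL : ∀ u, norm (φ u) ≤ L * norm u) (v : List (α × Bool)) {m : ℕ} (hm : m ≤ norm (φ (mk v))) :
    ∃ k, m ≤ gromov (φ (mk (v.take k))) (φ (mk v)) ∧ norm (φ (mk (v.take k))) ≤ m + L := by
  classical
  have hex : ∃ k, m ≤ gromov (φ (mk (v.take k))) (φ (mk v)) :=
    ⟨v.length, by rwa [List.take_length, gromov_self]⟩
  refine ⟨Nat.find hex, Nat.find_spec hex, ?_⟩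
  have hspec := Nat.find_spec hex
  rcases hk : Nat.find hex with _ | j
  · simp [← one_eq_mk]
  rw [hk] at hspec
  have hj : ¬ m ≤ gromov (φ (mk (v.take j))) (φ (mk v)) := Nat.find_min hex (by omega)
  have h1 := min_gromov_le (φ (mk (v.take j))) (φ (mk (v.take (j + 1)))) (φ (mk v))
  have h2 := norm_inv_mul (φ (mk (v.take j))) (φ (mk (v.take (j + 1))))
  have h3 := gromov_le_left (φ (mk (v.take j))) (φ (mk (v.take (j + 1))))
  have h4 : norm ((φ (mk (v.take j)))⁻¹ * φ (mk (v.take (j + 1)))) ≤ L := by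
    have e : (φ (mk (v.take j)))⁻¹ * φ (mk (v.take (j + 1))) = φ (mk ((v.drop j).take 1)) := by
      rw [List.take_add, ← mul_mk, _root_.map_mul, inv_mul_cancel_left]
    rw [e]
    refine (hL _).trans ((Nat.mul_le_mul_left L norm_mk_le).trans ?_)
    exact (Nat.mul_le_mul_left L (List.length_take_le 1 _)).trans (by simp)
  omega

variable [Finite α]

theorem exists_norm_apply_le (φ : MulAut (FreeGroup α)) : ∃ L, ∀ u, norm (φ u) ≤ L * norm u := by
  have := Fintype.ofFinite α
  refine ⟨∑ l : α × Bool, norm (φ (mk [l])), fun u => ?_⟩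
  suffices ∀ w : List (α × Bool),
      norm (φ (mk w)) ≤ (∑ l : α × Bool, norm (φ (mk [l]))) * w.length by
    simpa only [mk_toWord] using! this u.toWord
  intro w
  induction w with
  | nil => simp [← one_eq_mk]
  | cons l w ih =>
    have h1 : φ (mk (l :: w)) = φ (mk [l]) * φ (mk w) := by
      rw [← _root_.map_mul, mul_mk]
      rfl
    have h2 := Finset.single_le_sum (f := fun l : α × Bool => norm (φ (mk [l])))
      (fun _ _ => Nat.zero_le _) (Finset.mem_univ l)
    rw [h1, List.length_cons, mul_add, mul_one]
    exact (norm_mul_le _ _).trans (by omega)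

/-- An automorphism of a free group of finite rank cancels only boundedly many letters in the image
of a reduced product. -/
theorem bounded_cancellation (φ : MulAut (FreeGroup α)) :
    ∃ B, ∀ u v : List (α × Bool), IsReduced (u ++ v) →
      gromov (φ (mk u))⁻¹ (φ (mk v)) ≤ B := by
  obtain ⟨L, hL⟩ := exists_norm_apply_le φ
  obtain ⟨L', hL'⟩ := exists_norm_apply_le φ⁻¹
  refine ⟨L * (L' * (2 * L)), fun u v huv => ?_⟩
  set m := gromov (φ (mk u))⁻¹ (φ (mk v)) with hm
  have hu : (φ (mk u))⁻¹ = φ (mk (invRev u)) := by rw [← inv_mk, _root_.map_inv]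
  rw [hu] at hm
  obtain ⟨k, h1, h2⟩ := exists_take_le_gromov hL (invRev u) (hm ▸ gromov_le_left _ _)
  obtain ⟨j, h3, h4⟩ := exists_take_le_gromov hL v (hm ▸ gromov_le_right _ _)
  set a := (invRev u).take k
  set b := v.take j
  have h5 := min_gromov_le (φ (mk a)) (φ (mk (invRev u))) (φ (mk v))
  have h6 := min_gromov_le (φ (mk a)) (φ (mk v)) (φ (mk b))
  rw [gromov_comm (φ (mk v))] at h6
  have h7 := norm_inv_mul (φ (mk a)) (φ (mk b))
  -- Both images share `m` letters and have length at most `m + L`. Applying `φ⁻¹` bounds the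
  -- distance of `a` and `b`, which is the sum of their lengths because nothing cancels between
  -- them; so `a` is short, and so is its image.
  have h8 : norm ((φ (mk a))⁻¹ * φ (mk b)) ≤ 2 * L := by omega
  have h9 : norm ((mk a)⁻¹ * mk b) ≤ L' * (2 * L) := by
    have := hL' ((φ (mk a))⁻¹ * φ (mk b))
    rw [← _root_.map_inv, ← _root_.map_mul, MulAut.inv_apply_self] at this
    refine this.trans (Nat.mul_le_mul_left L' ?_)
    rwa [_root_.map_mul, _root_.map_inv]
  have hred : IsReduced (invRev a ++ b) := by
    refine huv.of_isInfix ⟨invRev ((invRev u).drop k), v.drop j, ?_⟩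
    have e : invRev ((invRev u).drop k) ++ invRev a = u := by
      rw [← invRev_append, List.take_append_drop, invRev_invRev]
    rw [← List.append_assoc, e, List.append_assoc, List.take_append_drop]
  rw [inv_mk, mul_mk, norm_mk_of_isReduced hred, List.length_append, invRev_length] at h9
  calc m ≤ norm (φ (mk a)) := h1.trans (gromov_le_left _ _)
    _ ≤ L * norm (mk a) := hL _
    _ ≤ L * (L' * (2 * L)) := Nat.mul_le_mul_left L (norm_mk_le.trans (by omega))

end Cancellation

/-! ### Powers inside reduced words -/

section Power

variable {α : Type*} [DecidableEq α]

/-- The reduced word of `w` contains a `k`-th power of a non-empty word. -/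
def HasPower (w : FreeGroup α) (k : ℕ) : Prop :=
  ∃ y : List (α × Bool), y ≠ [] ∧ (List.replicate k y).flatten <:+: w.toWord

theorem length_le_length_flatten_replicate {β : Type*} {y : List β} (hy : y ≠ []) (k : ℕ) :
    k ≤ (List.replicate k y).flatten.length := by
  have := List.length_pos_of_ne_nil hy
  simp only [List.length_flatten, List.map_replicate, List.sum_replicate, smul_eq_mul]
  exact Nat.le_mul_of_pos_right k this

theorem HasPower.le_norm {w : FreeGroup α} {k : ℕ} (h : HasPower w k) : k ≤ norm w := by
  obtain ⟨y, hy, hw⟩ := h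
  exact (length_le_length_flatten_replicate hy k).trans hw.length_le

theorem HasPower.mono {w : FreeGroup α} {k j : ℕ} (h : HasPower w k) (hj : j ≤ k) :
    HasPower w j := by
  obtain ⟨y, hy, hw⟩ := h
  obtain ⟨i, rfl⟩ := Nat.exists_eq_add_of_le hj
  refine ⟨y, hy, List.IsInfix.trans ?_ hw⟩
  rw [List.replicate_add, List.flatten_append]
  exact (List.prefix_append _ _).isInfix

/-- The buffers `e` and `f` absorb what is cut off at the two ends, so `z` remains intact. -/
theorem isInfix_of_append_eq {β : Type*} {p t c e z f d s' : List β}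
    (h1 : p ++ t = c ++ e ++ z ++ f ++ d) (hp : p.length ≤ e.length) {s q : List β}
    (h2 : s ++ t = s' ++ q) (hq : q.length ≤ f.length) : z <:+: s' := by
  have h3 : p ++ t = (c ++ e) ++ (z ++ f ++ d) := by simpa using h1
  obtain ⟨e', he⟩ := List.prefix_of_prefix_length_le (List.prefix_append p t)
    (h3 ▸ List.prefix_append (c ++ e) _) (by rw [List.length_append]; omega)
  rw [← he, List.append_assoc, List.append_cancel_left_eq] at h3
  have h4 : (s ++ e' ++ z) ++ (f ++ d) = s' ++ q := by
    rw [← h2, h3]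
    simp only [List.append_assoc]
  obtain ⟨f', hf⟩ := List.suffix_of_suffix_length_le (List.suffix_append s' q)
    (h4 ▸ List.suffix_append (s ++ e' ++ z) _) (by rw [List.length_append]; omega)
  rw [← hf, ← List.append_assoc, List.append_cancel_right_eq] at h4
  exact ⟨s ++ e', f', h4⟩

/-- The image of `y ^ k` is `c z ^ k c⁻¹` with `z` cyclically reduced. At most `B` letters cancel at
each end, and `B` copies of `z` have at least `B` letters. -/
theorem HasPower.apply {φ : MulAut (FreeGroup α)} {B : ℕ}
    (hB : ∀ u v : List (α × Bool), IsReduced (u ++ v) → gromov (φ (mk u))⁻¹ (φ (mk v)) ≤ B)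
    {w : FreeGroup α} {k : ℕ} (h : HasPower w k) : HasPower (φ w) (k - 2 * B) := by
  obtain ⟨y, hy, P, Q, hw⟩ := h
  by_cases hk : k ≤ 2 * B
  · exact ⟨y, hy, by simp [Nat.sub_eq_zero_of_le hk]⟩
  obtain ⟨j, rfl⟩ : ∃ j, k = j + 1 := ⟨k - 1, by omega⟩
  set M := (List.replicate (j + 1) y).flatten with hM
  have hred : IsReduced (P ++ M ++ Q) := hw ▸ isReduced_toWord
  have hyred : IsReduced y := hred.of_isInfix ⟨P, (List.replicate j y).flatten ++ Q, by
    simp [hM, List.replicate_succ]⟩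
  have hy1 : φ (mk y) ≠ 1 := by
    rw [Ne, EmbeddingLike.map_eq_one_iff, ← toWord_eq_nil_iff, toWord_mk_of_isReduced hyred]
    exact hy
  have hMk : φ (mk M) = φ (mk y) ^ (j + 1) := by
    rw [← map_pow, pow_mk]
  have hN := toWord_pow_succ (φ (mk y)) j
  rw [← hMk] at hN
  set c := reduceCyclically.conjugator (φ (mk y)).toWord
  set z := reduceCyclically (φ (mk y)).toWord
  have hz : z ≠ [] := reduceCyclically_ne_nil hy1
  refine ⟨z, hz, ?_⟩
  have hsplit : (List.replicate (j + 1) z).flatten = (List.replicate B z).flatten ++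
      (List.replicate (j + 1 - 2 * B) z).flatten ++ (List.replicate B z).flatten := by
    rw [← List.flatten_append, ← List.flatten_append, ← List.replicate_add, ← List.replicate_add]
    congr 2
    omega
  rw [hsplit] at hN
  have hlen := length_le_length_flatten_replicate hz B
  obtain ⟨p, s, t, -, hp2, hp3, hp4⟩ := gromov_spec (φ (mk P))⁻¹ (φ (mk M))
  have hpB := hB P M (hred.of_isInfix ⟨[], Q, by simp⟩)
  obtain ⟨p', s', t', hp1', -, hp3', hp4'⟩ := gromov_spec (φ (mk (P ++ M)))⁻¹ (φ (mk Q))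
  have hpB' := hB (P ++ M) Q hred
  have hφw : (φ w).toWord = invRev s' ++ t' := by
    rw [← hp3', inv_inv, ← _root_.map_mul, mul_mk, hw, mk_toWord]
  have h2 : invRev s ++ t = invRev s' ++ invRev p' := by
    rw [← hp3, inv_inv, ← _root_.map_mul, mul_mk, ← invRev_append, ← hp1', toWord_inv, invRev_invRev]
  rw [hφw]
  refine List.IsInfix.trans (isInfix_of_append_eq (p := p) (t := t) (c := c)
    (e := (List.replicate B z).flatten) (f := (List.replicate B z).flatten) (d := invRev c)
    ?_ ?_ h2 ?_) (List.prefix_append _ _).isInfix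
  · rw [← hp2, hN]
    simp only [List.append_assoc]
  · omega
  · rw [invRev_length]
    omega

end Power

/-! ### Cyclically reduced words and their conjugates -/

section Conjugates

variable {α : Type*}

/-- The square of `w ++ v` is an infix of the cube of `v ++ w`. -/
theorem IsCyclicallyReduced.rotate {v w : List (α × Bool)} (h : IsCyclicallyReduced (v ++ w)) :
    IsCyclicallyReduced (w ++ v) := by
  have h3 := (h.flatten_replicate 3).isReduced
  have h2 : IsReduced ((w ++ v) ++ (w ++ v)) := h3.of_isInfix ⟨v, w, by simp [List.replicate_succ]⟩
  rw [isReduced_append_iff] at h2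
  exact ⟨h2.1, h2.2.2⟩

theorem IsCyclicallyReduced.of_isRotated {v w : List (α × Bool)} (h : IsCyclicallyReduced v)
    (hr : w ~r v) : IsCyclicallyReduced w := by
  obtain ⟨n, hn, rfl⟩ := List.isRotated_iff_mod.1 hr.symm
  rw [List.rotate_eq_drop_append_take hn]
  exact IsCyclicallyReduced.rotate (by rwa [List.take_append_drop])

theorem isReduced_cons_append_singleton {l : α × Bool} {w : List (α × Bool)} (hw : IsReduced w)
    (hne : w ≠ []) (h1 : ∀ b ∈ w.head?, b ≠ invLetter l) (h2 : ∀ b ∈ w.getLast?, b ≠ l) :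
    IsReduced ([l] ++ w ++ [invLetter l]) := by
  refine IsReduced.append_overlap ?_ ?_ hne
  · rw [isReduced_append_iff]
    refine ⟨IsReduced.singleton, hw, fun a ha b hb hab => ?_⟩
    obtain rfl : l = a := by simpa using ha
    rw [(eq_or_eq_invLetter hab.symm).resolve_right (h1 b hb)]
  · rw [isReduced_append_iff]
    refine ⟨hw, IsReduced.singleton, fun a ha b hb hab => ?_⟩
    obtain rfl : invLetter l = b := by simpa using hb
    rw [(eq_or_eq_invLetter hab).resolve_right (by simpa using h2 a ha)]

variable [DecidableEq α]

/-- The reduced word of a conjugate of a cyclically reduced word is a conjugate of a rotation. -/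
theorem exists_toWord_conj {W : List (α × Bool)} (hW : IsCyclicallyReduced W) (hne : W ≠ [])
    (u : FreeGroup α) :
    ∃ c R, R ~r W ∧ (u * mk W * u⁻¹).toWord = c ++ R ++ invRev c := by
  suffices ∀ U : List (α × Bool), ∃ c R, R ~r W ∧
      (mk U * mk W * (mk U)⁻¹).toWord = c ++ R ++ invRev c by
    simpa only [mk_toWord] using this u.toWord
  intro U
  induction U with
  | nil => exact ⟨[], W, List.IsRotated.refl W, by
      simp [← one_eq_mk, hW.isReduced.reduce_eq]⟩
  | cons l U ih =>
    obtain ⟨c, R, hR, h⟩ := ih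
    set g := mk U * mk W * (mk U)⁻¹ with hg
    have hred : IsReduced (c ++ R ++ invRev c) := h ▸ isReduced_toWord
    have hl : mk (l :: U) * mk W * (mk (l :: U))⁻¹ = mk [l] * g * (mk [l])⁻¹ := by
      rw [hg, show l :: U = [l] ++ U from rfl, ← mul_mk]
      group
    rw [hl, ← mk_toWord (x := g), h]
    have hne' : R ≠ [] := by
      rintro rfl
      exact hne (List.isRotated_nil_iff'.1 hR).symm
    -- Conjugating by one more letter has three outcomes: it lengthens `c`; it rotates `R` when `c`
    -- is empty; or it cancels the first letter of `c`.
    have hlong : (∀ b ∈ (c ++ R ++ invRev c).head?, b ≠ invLetter l) →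
        (∀ b ∈ (c ++ R ++ invRev c).getLast?, b ≠ l) →
        ∃ c' R', R' ~r W ∧
          (mk [l] * mk (c ++ R ++ invRev c) * (mk [l])⁻¹).toWord = c' ++ R' ++ invRev c' := by
      intro h1 h2
      refine ⟨l :: c, R, hR, ?_⟩
      rw [← mk_invLetter, mul_mk, mul_mk, toWord_mk_of_isReduced
        (isReduced_cons_append_singleton hred (by simp [hne']) h1 h2), invRev_cons']
      simp
    have hrot : ∀ R', R' ~r R → mk [l] * mk R * (mk [l])⁻¹ = mk R' →
        ∃ c' R', R' ~r W ∧ (mk [l] * mk R * (mk [l])⁻¹).toWord = c' ++ R' ++ invRev c' := by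
      intro R' h1 h2
      refine ⟨[], R', h1.trans hR, ?_⟩
      rw [h2, toWord_mk_of_isReduced (hW.of_isRotated (h1.trans hR)).isReduced]
      simp
    rcases c with _ | ⟨a, c⟩
    · simp only [List.nil_append, invRev_empty, List.append_nil] at hlong hred ⊢
      by_cases h1 : ∀ b ∈ R.head?, b ≠ invLetter l
      · by_cases h2 : ∀ b ∈ R.getLast?, b ≠ l
        · exact hlong h1 h2
        push Not at h2
        obtain ⟨b, hb, rfl⟩ := h2
        obtain ⟨r, rfl⟩ := List.getLast?_eq_some_iff.1 hb
        refine hrot ([b] ++ r) List.isRotated_append ?_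
        rw [← mul_mk, ← mul_mk, mul_assoc, mul_assoc, mul_inv_cancel, mul_one]
      · push Not at h1
        obtain ⟨b, hb, rfl⟩ := h1
        obtain ⟨r, rfl⟩ := List.head?_eq_some_iff.1 hb
        refine hrot (r ++ [invLetter l]) List.isRotated_append ?_
        rw [← mul_mk, show invLetter l :: r = [invLetter l] ++ r from rfl, ← mul_mk, mk_invLetter,
          mul_inv_cancel_left]
    · by_cases ha : a = invLetter l
      · subst ha
        refine ⟨c, R, hR, ?_⟩
        have hr : IsReduced (c ++ R ++ invRev c) := hred.of_isInfix ⟨[invLetter l], [l], by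
          simp [invRev_cons']⟩
        rw [← toWord_mk_of_isReduced hr, toWord_inj, invRev_cons', invLetter_invLetter,
          ← List.append_assoc, ← mul_mk, List.cons_append, List.cons_append,
          show ∀ q, invLetter l :: q = [invLetter l] ++ q from fun _ => rfl, ← mul_mk, mk_invLetter]
        group
      · refine hlong (by simpa using ha) ?_
        rw [invRev_cons', ← List.append_assoc]
        simp only [List.getLast?_append, List.getLast?_singleton, Option.some_or,
          Option.mem_some_iff, forall_eq']
        rintro rfl
        simp at ha

/-- A high power of a letter in a cyclically reduced word persists in all conjugates. -/
theorem hasPower_conj {W : List (α × Bool)} (hW : IsCyclicallyReduced W) {s : α × Bool} {k : ℕ}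
    (h : List.replicate k s <:+: W) (u : FreeGroup α) (hne : W ≠ []) :
    HasPower (u * mk W * u⁻¹) (k / 2) := by
  obtain ⟨c, R, hR, hu⟩ := exists_toWord_conj hW hne u
  refine ⟨[s], by simp, ?_⟩
  have hs : ∀ j, (List.replicate j [s]).flatten = List.replicate j s := by simp
  rw [hu, hs]
  refine List.IsInfix.trans ?_ (List.infix_append c R (invRev c))
  obtain ⟨n, hn, rfl⟩ := List.isRotated_iff_mod.1 hR.symm
  rw [List.rotate_eq_drop_append_take hn]
  obtain ⟨a, b, rfl⟩ := h
  have hk : List.replicate k s = List.replicate (k / 2) s ++ List.replicate (k - k / 2) s := by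
    rw [← List.replicate_add]
    congr 1
    omega
  have e : a ++ List.replicate k s ++ b =
      (a ++ List.replicate (k / 2) s) ++ (List.replicate (k - k / 2) s ++ b) := by
    rw [hk]
    simp only [List.append_assoc]
  -- The rotation cuts the word at position `n`. One of the two halves of the power lies wholly on
  -- one side of the cut, which is why the exponent is halved.
  by_cases hna : n ≤ (a ++ List.replicate (k / 2) s).length
  · refine List.IsInfix.trans ?_ (List.prefix_append _ _).isInfix
    rw [e, List.drop_append_of_le_length hna]
    refine List.IsInfix.trans ?_ (List.suffix_append _ _).isInfix
    refine List.IsInfix.trans ?_ (List.prefix_append _ _).isInfix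
    rw [show k - k / 2 = k / 2 + (k - k / 2 - k / 2) by omega, List.replicate_add]
    exact (List.prefix_append _ _).isInfix
  · refine List.IsInfix.trans ?_ (List.suffix_append _ _).isInfix
    rw [e, List.take_append, List.take_of_length_le (by omega)]
    refine List.IsInfix.trans ?_ (List.prefix_append _ _).isInfix
    exact (List.suffix_append _ _).isInfix

end Conjugates

end FreeGroup

/-! ### Comparison of word norms -/

section WordNorm

variable {G H : Type*} [Group G] [Group H]

theorem wordNorm_prod_le {S : Set G} {w : List G} (hw : ∀ x ∈ w, x ∈ S ∨ x⁻¹ ∈ S) :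
    wordNorm S w.prod ≤ w.length :=
  Nat.sInf_le ⟨w, hw, rfl, rfl⟩

theorem wordNorm_image_le {S : Set G} (hS : Subgroup.closure S = ⊤) (f : G →* H) (g : G) :
    wordNorm (f '' S) (f g) ≤ wordNorm S g := by
  obtain ⟨w, hw, rfl, hl⟩ := exists_word hS g
  rw [← hl, map_list_prod, ← List.length_map f]
  refine wordNorm_prod_le fun x hx => ?_
  obtain ⟨y, hy, rfl⟩ := List.mem_map.1 hx
  refine (hw y hy).imp (fun h => ⟨y, h, rfl⟩) fun h => ⟨y⁻¹, h, map_inv f y⟩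

theorem closure_image_eq_top {S : Set G} (hS : Subgroup.closure S = ⊤) {f : G →* H}
    (hf : Function.Surjective f) : Subgroup.closure (f '' S) = ⊤ := by
  rw [← MonoidHom.map_closure, hS, ← MonoidHom.range_eq_map, MonoidHom.range_eq_top.2 hf]

theorem exists_wordNorm_le_mul {S : Set G} (hS : Subgroup.closure S = ⊤) {T : Set H}
    (hT : T.Finite) (hT' : Subgroup.closure T = ⊤) (f : H →* G) :
    ∃ C : ℕ, ∀ h, wordNorm S (f h) ≤ C * wordNorm T h := by
  obtain ⟨C, hC⟩ := (hT.image fun t => wordNorm S (f t)).bddAbove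
  have hC' : ∀ t ∈ T, wordNorm S (f t) ≤ C := fun t ht => hC ⟨t, ht, rfl⟩
  refine ⟨C, fun h => ?_⟩
  obtain ⟨w, hw, rfl, hl⟩ := exists_word hT' h
  rw [← hl]
  clear hl
  induction w with
  | nil => simp [wordNorm_one]
  | cons x w ih =>
    have h1 := ih fun y hy => hw y (List.mem_cons_of_mem x hy)
    have h2 : wordNorm S (f x) ≤ C := by
      rcases hw x List.mem_cons_self with hx | hx
      · exact hC' x hx
      · rw [← wordNorm_inv hS, ← map_inv]
        exact hC' _ hx
    rw [List.prod_cons, map_mul, List.length_cons, mul_add, mul_one]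
    exact (wordNorm_mul_le hS _ _).trans (by omega)

theorem wordNorm_zpow_le {S : Set G} (hS : Subgroup.closure S = ⊤) (g : G) (a : ℤ) :
    wordNorm S (g ^ a) ≤ a.natAbs * wordNorm S g := by
  have key : ∀ m : ℕ, wordNorm S (g ^ m) ≤ m * wordNorm S g := by
    intro m
    induction m with
    | zero => simp [wordNorm_one]
    | succ m ih =>
      rw [pow_succ, add_mul, one_mul]
      exact (wordNorm_mul_le hS _ _).trans (by omega)
  obtain ⟨m, rfl | rfl⟩ := a.eq_nat_or_neg
  · simpa using key m
  · rw [zpow_neg, wordNorm_inv hS]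
    simpa using key m

end WordNorm

/-! ### Undistorted pairs of commuting elements -/

section Pair

variable {G : Type*} [Group G]

/-- The elements `φ` and `ψ` commute, and the word norms of `φ ^ a * ψ ^ b` grow linearly in
`|a| + |b|`. -/
structure IsUndistortedPair (φ ψ : G) : Prop where
  commute : Commute φ ψ
  linear_growth : ∀ S : Set G, S.Finite → Subgroup.closure S = ⊤ →
    ∃ K : ℕ, ∀ a b : ℤ, a.natAbs + b.natAbs ≤ K * (wordNorm S (φ ^ a * ψ ^ b) + 1)

/-- The homomorphism `(a, b) ↦ φ ^ a * ψ ^ b` for commuting `φ` and `ψ`. -/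
def zpowPairHom {φ ψ : G} (h : Commute φ ψ) : Multiplicative (ℤ × ℤ) →* G where
  toFun x := φ ^ x.toAdd.1 * ψ ^ x.toAdd.2
  map_one' := by simp
  map_mul' x y := by
    simp only [toAdd_mul, Prod.fst_add, Prod.snd_add, zpow_add]
    rw [mul_assoc, mul_assoc, ← mul_assoc (φ ^ y.toAdd.1), ((h.zpow_zpow _ _).eq), mul_assoc]

theorem zpowPairHom_apply {φ ψ : G} (h : Commute φ ψ) (a b : ℤ) :
    zpowPairHom h (Multiplicative.ofAdd (a, b)) = φ ^ a * ψ ^ b := rfl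

theorem mem_closure_pair_left (φ ψ : G) : φ ∈ Subgroup.closure {φ, ψ} :=
  Subgroup.subset_closure (by simp)

theorem mem_closure_pair_right (φ ψ : G) : ψ ∈ Subgroup.closure {φ, ψ} :=
  Subgroup.subset_closure (by simp)

theorem range_zpowPairHom {φ ψ : G} (h : Commute φ ψ) :
    (zpowPairHom h).range = Subgroup.closure {φ, ψ} := by
  apply le_antisymm
  · rintro _ ⟨x, rfl⟩
    exact Subgroup.mul_mem _ (Subgroup.zpow_mem _ (mem_closure_pair_left φ ψ) _)
      (Subgroup.zpow_mem _ (mem_closure_pair_right φ ψ) _)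
  · rw [Subgroup.closure_le]
    rintro x (rfl | rfl)
    · exact ⟨Multiplicative.ofAdd (1, 0), by simp [zpowPairHom_apply]⟩
    · exact ⟨Multiplicative.ofAdd (0, 1), by simp [zpowPairHom_apply]⟩

namespace IsUndistortedPair

variable {φ ψ : G}

/-- All powers of an element of the kernel have word norm `0`, while linear growth would make their
coordinates unbounded unless they vanish. -/
theorem injective_zpowPairHom [hG : Group.FG G] (h : IsUndistortedPair φ ψ) :
    Function.Injective (zpowPairHom h.commute) := by
  obtain ⟨S, hS⟩ := hG.out
  obtain ⟨K, hK⟩ := h.linear_growth S S.finite_toSet hS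
  rw [injective_iff_map_eq_one]
  intro x hx
  have key : ∀ m : ℕ, m * (x.toAdd.1.natAbs + x.toAdd.2.natAbs) ≤ K := by
    intro m
    have hm : φ ^ (x ^ m).toAdd.1 * ψ ^ (x ^ m).toAdd.2 = 1 := by
      change zpowPairHom h.commute (x ^ m) = 1
      rw [map_pow, hx, one_pow]
    have := hK (x ^ m).toAdd.1 (x ^ m).toAdd.2
    rw [hm, wordNorm_one] at this
    simpa [Int.natAbs_mul, mul_add] using this
  have h0 : x.toAdd.1.natAbs + x.toAdd.2.natAbs = 0 := by
    by_contra h0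
    have h1 := key (K + 1)
    have h2 := Nat.le_mul_of_pos_right (K + 1) (Nat.pos_of_ne_zero h0)
    omega
  apply Multiplicative.toAdd.injective
  rw [Nat.add_eq_zero_iff, Int.natAbs_eq_zero, Int.natAbs_eq_zero] at h0
  exact Prod.ext h0.1 h0.2

theorem nonempty_mulEquiv [Group.FG G] (h : IsUndistortedPair φ ψ) :
    Nonempty (Subgroup.closure {φ, ψ} ≃* Multiplicative (ℤ × ℤ)) :=
  ⟨((MonoidHom.ofInjective h.injective_zpowPairHom).trans
    (MulEquiv.subgroupCongr (range_zpowPairHom h.commute))).symm⟩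

theorem infinite_zpowers [Group.FG G] (h : IsUndistortedPair φ ψ) :
    (Subgroup.zpowers φ : Set G).Infinite := by
  have hinj : Function.Injective fun a : ℤ => φ ^ a := by
    intro a b hab
    have := h.injective_zpowPairHom (a₁ := Multiplicative.ofAdd (a, 0))
      (a₂ := Multiplicative.ofAdd (b, 0)) (by simpa [zpowPairHom_apply] using hab)
    simpa using this
  refine (Set.infinite_range_of_injective hinj).mono ?_
  rintro _ ⟨a, rfl⟩
  exact Subgroup.zpow_mem_zpowers φ a

theorem isUndistorted (h : IsUndistortedPair φ ψ) :
    IsUndistorted (Subgroup.closure {φ, ψ}) := by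
  intro S hS hS' T hT hT'
  obtain ⟨K, hK⟩ := h.linear_growth S hS hS'
  obtain ⟨C, hC⟩ := exists_wordNorm_le_mul hS' hT hT' (Subgroup.closure {φ, ψ}).subtype
  let φ' : Subgroup.closure {φ, ψ} := ⟨φ, mem_closure_pair_left φ ψ⟩
  let ψ' : Subgroup.closure {φ, ψ} := ⟨ψ, mem_closure_pair_right φ ψ⟩
  let D := wordNorm T φ' + wordNorm T ψ'
  have key : ∀ g : Subgroup.closure {φ, ψ}, wordNorm T g ≤ 2 * D * K * wordNorm S (g : G) := by
    intro g
    obtain ⟨x, hx⟩ : (g : G) ∈ (zpowPairHom h.commute).range := by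
      rw [range_zpowPairHom]
      exact g.2
    have hg : g = φ' ^ x.toAdd.1 * ψ' ^ x.toAdd.2 := by
      ext
      rw [← hx]
      rfl
    have h1 : wordNorm T g ≤ D * (x.toAdd.1.natAbs + x.toAdd.2.natAbs) := by
      rw [hg]
      have e1 := wordNorm_zpow_le hT' φ' x.toAdd.1
      have e2 := wordNorm_zpow_le hT' ψ' x.toAdd.2
      have e3 := wordNorm_mul_le hT' (φ' ^ x.toAdd.1) (ψ' ^ x.toAdd.2)
      have e4 : wordNorm T φ' ≤ D := Nat.le_add_right _ _
      have e5 : wordNorm T ψ' ≤ D := Nat.le_add_left _ _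
      have e6 := Nat.mul_le_mul_left x.toAdd.1.natAbs e4
      have e7 := Nat.mul_le_mul_left x.toAdd.2.natAbs e5
      linarith
    -- The additive `1` in the growth bound is absorbed for a non-trivial `g`, whose norm is at
    -- least `1`; this is the source of the factor `2`.
    rcases Nat.eq_zero_or_pos (wordNorm S (g : G)) with h0 | h0
    · have : g = 1 := Subtype.ext (eq_one_of_wordNorm hS' h0)
      rw [this, wordNorm_one]
      exact Nat.zero_le _
    · have h2 := hK x.toAdd.1 x.toAdd.2
      rw [show φ ^ x.toAdd.1 * ψ ^ x.toAdd.2 = (g : G) from hx] at h2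
      calc wordNorm T g ≤ D * (K * (wordNorm S (g : G) + 1)) := h1.trans (Nat.mul_le_mul_left D h2)
        _ ≤ D * (K * (wordNorm S (g : G) + wordNorm S (g : G))) := by gcongr; exact h0
        _ = 2 * D * K * wordNorm S (g : G) := by ring
  refine ⟨(2 * D * K + C + 1 : ℕ), by positivity, fun g => ⟨?_, ?_⟩⟩
  · have := key g
    exact_mod_cast this.trans (Nat.mul_le_mul_right _ (by omega))
  · have := hC g
    exact_mod_cast this.trans (Nat.mul_le_mul_right _ (by omega))

end IsUndistortedPair

/-- Elements whose images under a surjection form an undistorted pair. -/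
theorem IsUndistortedPair.of_map {H : Type*} [Group H] {f : G →* H} (hf : Function.Surjective f)
    {φ ψ : G} (hc : Commute φ ψ) (h : IsUndistortedPair (f φ) (f ψ)) : IsUndistortedPair φ ψ where
  commute := hc
  linear_growth S hS hS' := by
    obtain ⟨K, hK⟩ := h.linear_growth (f '' S) (hS.image f) (closure_image_eq_top hS' hf)
    refine ⟨K, fun a b => (hK a b).trans ?_⟩
    rw [← map_zpow, ← map_zpow, ← map_mul]
    have := wordNorm_image_le hS' f (φ ^ a * ψ ^ b)
    gcongr

theorem IsUndistortedPair.symm {φ ψ : G} (h : IsUndistortedPair φ ψ) : IsUndistortedPair ψ φ where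
  commute := h.commute.symm
  linear_growth S hS hS' := by
    obtain ⟨K, hK⟩ := h.linear_growth S hS hS'
    refine ⟨K, fun a b => ?_⟩
    rw [add_comm, ← (h.commute.zpow_zpow b a).eq]
    exact hK b a

end Pair

/-! ### Word norms in outer automorphism groups of free groups -/

section OutGrowth

open FreeGroup

variable {α : Type*} [DecidableEq α]

theorem hasPower_list_prod {B : ℕ} {L : List (MulAut (FreeGroup α))}
    (hL : ∀ φ ∈ L, ∀ (w : FreeGroup α) (k : ℕ), HasPower w k → HasPower (φ w) (k - B))
    {w : FreeGroup α} {k : ℕ} (h : HasPower w k) : HasPower (L.prod w) (k - L.length * B) := by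
  induction L with
  | nil => simpa using h
  | cons φ L ih =>
    have h1 := ih fun ψ hψ => hL ψ (List.mem_cons_of_mem φ hψ)
    have h2 := hL φ List.mem_cons_self _ _ h1
    rw [List.prod_cons, MulAut.mul_apply, List.length_cons, add_mul, one_mul, ← Nat.sub_sub]
    exact h2

/-- An upper bound for the powers in cyclic words in terms of word norms in the outer automorphism
group. -/
theorem exists_power_le_wordNorm [Finite α] {S : Set (Out (FreeGroup α))} (hS : S.Finite)
    (hS' : Subgroup.closure S = ⊤) :
    ∃ B : ℕ, ∀ (θ : MulAut (FreeGroup α)) (w u : FreeGroup α) (W : List (α × Bool)) (s : α × Bool)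
      (k : ℕ), θ w = u * mk W * u⁻¹ → IsCyclicallyReduced W → W ≠ [] → List.replicate k s <:+: W →
        k / 2 ≤ wordNorm S (QuotientGroup.mk θ) * B + norm w := by
  choose B hB using fun φ : MulAut (FreeGroup α) => bounded_cancellation φ
  -- One cancellation constant serves the chosen lifts of all generators and of their inverses.
  obtain ⟨C, hC⟩ := ((hS.union (hS.image fun x => x⁻¹)).image fun x => B x.out).bddAbove
  refine ⟨2 * C, fun θ w u W s k hθ hW hne hk => ?_⟩
  obtain ⟨L, hL, hprod, hlen⟩ := exists_word hS' (QuotientGroup.mk θ : Out (FreeGroup α))⁻¹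
  rw [wordNorm_inv hS'] at hlen
  have hτ : (QuotientGroup.mk (L.map Quotient.out).prod : Out (FreeGroup α)) =
      (QuotientGroup.mk θ)⁻¹ := by
    rw [← hprod, ← QuotientGroup.mk'_apply, map_list_prod, List.map_map]
    congr 1
    conv_rhs => rw [← List.map_id L]
    refine List.map_congr_left fun x _ => ?_
    exact QuotientGroup.out_eq' x
  set τ := (L.map Quotient.out).prod with hτ'
  obtain ⟨g, hg⟩ : τ * θ ∈ Inn (FreeGroup α) := by
    rw [← QuotientGroup.eq_one_iff, QuotientGroup.mk_mul, hτ, inv_mul_cancel]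
  -- The lift `τ` inverts `θ` only up to conjugation by `g`. Conjugating by `a` beforehand cancels
  -- this, so that `τ` returns exactly `w`.
  obtain ⟨a, ha⟩ := τ.surjective g⁻¹
  have hpow : HasPower (a * u * mk W * (a * u)⁻¹) (k / 2) := hasPower_conj hW hk _ hne
  have hw : τ (a * u * mk W * (a * u)⁻¹) = w := by
    have e : a * u * mk W * (a * u)⁻¹ = a * θ w * a⁻¹ := by
      rw [hθ]
      group
    have hgw : τ (θ w) = g * w * g⁻¹ := by
      rw [← MulAut.mul_apply, ← hg, MulAut.conj_apply]
    rw [e, _root_.map_mul, _root_.map_mul, _root_.map_inv, ha, hgw]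
    group
  have key := hasPower_list_prod (B := 2 * C) (L := L.map Quotient.out) ?_ hpow
  · rw [← hτ', hw, List.length_map, hlen] at key
    have := key.le_norm
    omega
  · intro φ hφ v j hv
    obtain ⟨x, hx, rfl⟩ := List.mem_map.1 hφ
    refine (hv.apply (hB x.out)).mono ?_
    have : B x.out ≤ C := by
      refine hC ⟨x, ?_, rfl⟩
      rcases hL x hx with h | h
      · exact Or.inl h
      · exact Or.inr ⟨x⁻¹, h, inv_inv (G := Out (FreeGroup α)) x⟩
    omega

end OutGrowth

/-! ### Free abelian groups of rank two are unconstricted -/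

section Lattice

universe v

variable {X : Type v} [MetricSpace X] {c : X ≃ ℤ × ℤ}

theorem nearBiinfiniteGeodesics_of_lattice
    (hc : ∀ x y, dist x y = |((c x).1 - (c y).1 : ℝ)| + |((c x).2 - (c y).2 : ℝ)|) :
    NearBiinfiniteGeodesics X := by
  refine ⟨0, fun x => ⟨fun k => c.symm ((c x).1 + k, (c x).2), ?_, 0, ?_⟩⟩
  · refine Isometry.of_dist_eq fun k j => ?_
    rw [hc, Int.dist_eq]
    simp
  · rw [hc]
    simp

variable {ω : Ultrafilter ℕ} {b : ℕ → X} {d : ℕ → ℝ≥0}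

/-- The point `x` of the plane is the rescaled limit of the sequence `y` of lattice points, seen from
the observation points `b`. -/
def HasLimitCoords (c : X ≃ ℤ × ℤ) (ω : Ultrafilter ℕ) (b : ℕ → X) (d : ℕ → ℝ≥0) (y : ℕ → X)
    (x : ℝ × ℝ) : Prop :=
  Tendsto (fun i => (((c (y i)).1 - (c (b i)).1 : ℝ) / d i)) (ω : Filter ℕ) (𝓝 x.1) ∧
    Tendsto (fun i => (((c (y i)).2 - (c (b i)).2 : ℝ) / d i)) (ω : Filter ℕ) (𝓝 x.2)

theorem HasLimitCoords.dist_eq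
    (hc : ∀ x y, dist x y = |((c x).1 - (c y).1 : ℝ)| + |((c x).2 - (c y).2 : ℝ)|)
    {y z : ConeSeq ω b d} {p q : ℝ × ℝ} (hy : HasLimitCoords c ω b d y.1 p)
    (hz : HasLimitCoords c ω b d z.1 q) : dist y z = |p.1 - q.1| + |p.2 - q.2| := by
  refine tendsto_nhds_unique (ConeSeq.tendsto_dist y z) ?_
  refine (((hy.1.sub hz.1).abs).add ((hy.2.sub hz.2).abs)).congr fun i => ?_
  rw [hc, add_div, ← sub_div, ← sub_div, abs_div, abs_div, abs_of_nonneg (d i).coe_nonneg]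
  congr 3 <;> ring

theorem exists_tendsto_of_abs_le {f : ℕ → ℝ} {C : ℝ} (h : ∀ᶠ i in (ω : Filter ℕ), |f i| ≤ C) :
    ∃ l, Tendsto f (ω : Filter ℕ) (𝓝 l) := by
  obtain ⟨l, -, hl⟩ := (isCompact_Icc (a := -C) (b := C)).ultrafilter_le_nhds (ω.map f)
    (le_principal_iff.2 (h.mono fun i hi => abs_le.1 hi))
  exact ⟨l, hl⟩

theorem exists_hasLimitCoords
    (hc : ∀ x y, dist x y = |((c x).1 - (c y).1 : ℝ)| + |((c x).2 - (c y).2 : ℝ)|)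
    (y : ConeSeq ω b d) : ∃ p, HasLimitCoords c ω b d y.1 p := by
  obtain ⟨C, hC⟩ := y.2
  have key : ∀ᶠ i in (ω : Filter ℕ), |((c (y.1 i)).1 - (c (b i)).1 : ℝ) / d i| ≤ C ∧
      |((c (y.1 i)).2 - (c (b i)).2 : ℝ) / d i| ≤ C := by
    filter_upwards [hC] with i hi
    rw [hc, add_div] at hi
    rw [abs_div, abs_div, abs_of_nonneg (d i).coe_nonneg]
    have h1 : 0 ≤ |((c (y.1 i)).1 - (c (b i)).1 : ℝ)| / d i := by positivity
    have h2 : 0 ≤ |((c (y.1 i)).2 - (c (b i)).2 : ℝ)| / d i := by positivity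
    constructor <;> linarith
  obtain ⟨l, hl⟩ := exists_tendsto_of_abs_le (key.mono fun i hi => hi.1)
  obtain ⟨m, hm⟩ := exists_tendsto_of_abs_le (key.mono fun i hi => hi.2)
  exact ⟨(l, m), hl, hm⟩

theorem tendsto_floor_mul_div {l : Filter ℕ} (hd : Tendsto d l atTop) (hpos : ∀ i, 0 < d i)
    (x : ℝ) : Tendsto (fun i => (⌊x * d i⌋ : ℝ) / d i) l (𝓝 x) := by
  have hd' : Tendsto (fun i => ((d i : ℝ))⁻¹) l (𝓝 0) :=
    tendsto_inv_atTop_zero.comp (NNReal.tendsto_coe_atTop.2 hd)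
  refine tendsto_of_tendsto_of_tendsto_of_le_of_le (g := fun i => x - (d i : ℝ)⁻¹) (h := fun _ => x)
    (by simpa using tendsto_const_nhds.sub hd') tendsto_const_nhds (fun i => ?_) fun i => ?_
  · have h0 : (0 : ℝ) < d i := hpos i
    have := Int.lt_floor_add_one (x * d i)
    rw [le_div_iff₀ h0, sub_mul, inv_mul_cancel₀ h0.ne']
    linarith
  · have h0 : (0 : ℝ) < d i := hpos i
    exact (div_le_iff₀ h0).2 (Int.floor_le _)

/-- Rounding `p * d i` down to lattice points changes the rescaled coordinates by at most `1 / d i`,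
which tends to `0`. -/
theorem exists_coneSeq_hasLimitCoords
    (hc : ∀ x y, dist x y = |((c x).1 - (c y).1 : ℝ)| + |((c x).2 - (c y).2 : ℝ)|)
    (hd : Tendsto d (ω : Filter ℕ) atTop) (hpos : ∀ i, 0 < d i) (b : ℕ → X) (p : ℝ × ℝ) :
    ∃ y : ConeSeq ω b d, HasLimitCoords c ω b d y.1 p := by
  let y : ℕ → X := fun i =>
    c.symm ((c (b i)).1 + ⌊p.1 * d i⌋, (c (b i)).2 + ⌊p.2 * d i⌋)
  have h1 := tendsto_floor_mul_div hd hpos p.1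
  have h2 := tendsto_floor_mul_div hd hpos p.2
  have hlim : HasLimitCoords c ω b d y p := by
    constructor
    · simpa [y] using h1
    · simpa [y] using h2
  refine ⟨⟨y, |p.1| + |p.2| + 1, ?_⟩, hlim⟩
  have h3 := (hlim.1.abs.add hlim.2.abs).eventually (gt_mem_nhds (lt_add_one _))
  filter_upwards [h3] with i hi
  rw [hc, add_div]
  rw [abs_div, abs_div, abs_of_nonneg (d i).coe_nonneg] at hi
  exact hi.le

theorem not_isCutPoint_of_lattice
    (hc : ∀ x y, dist x y = |((c x).1 - (c y).1 : ℝ)| + |((c x).2 - (c y).2 : ℝ)|)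
    (hd : Tendsto d (ω : Filter ℕ) atTop) (hpos : ∀ i, 0 < d i) (b : ℕ → X)
    (p : AsymptoticCone ω b d) : ¬ IsCutPoint p := by
  choose f hf using exists_coneSeq_hasLimitCoords (ω := ω) hc hd hpos b
  have hdist : ∀ x y, dist (f x) (f y) = |x.1 - y.1| + |x.2 - y.2| := fun x y =>
    (hf x).dist_eq hc (hf y)
  have hcont : Continuous f := by
    refine (LipschitzWith.of_dist_le_mul (K := 2) fun x y => ?_).continuous
    rw [hdist, Prod.dist_eq, Real.dist_eq, Real.dist_eq]
    have h1 := le_max_left |x.1 - y.1| |x.2 - y.2|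
    have h2 := le_max_right |x.1 - y.1| |x.2 - y.2|
    push_cast
    linarith
  -- This is a continuous bijection from the plane, so the complement of a point of the cone is the
  -- image of a punctured plane.
  let F : ℝ × ℝ → AsymptoticCone ω b d := fun x => SeparationQuotient.mk (f x)
  have hF : Continuous F := SeparationQuotient.continuous_mk.comp hcont
  have hbij : Function.Bijective F := by
    constructor
    · intro x y hxy
      have h0 : dist (f x) (f y) = 0 := by
        rw [← SeparationQuotient.dist_mk]
        exact dist_eq_zero.2 hxy
      rw [hdist] at h0
      have h1 := abs_nonneg (x.1 - y.1)
      have h2 := abs_nonneg (x.2 - y.2)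
      exact Prod.ext (sub_eq_zero.1 (abs_eq_zero.1 (by linarith)))
        (sub_eq_zero.1 (abs_eq_zero.1 (by linarith)))
    · intro q
      obtain ⟨z, rfl⟩ := SeparationQuotient.surjective_mk q
      obtain ⟨x, hx⟩ := exists_hasLimitCoords hc z
      refine ⟨x, dist_eq_zero.1 ?_⟩
      rw [SeparationQuotient.dist_mk, (hf x).dist_eq hc hx]
      simp
  obtain ⟨x, rfl⟩ := hbij.2 p
  rw [IsCutPoint, not_not]
  have himg : F '' {x}ᶜ = {F x}ᶜ := by rw [Set.image_compl_eq hbij, Set.image_singleton]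
  rw [← himg]
  refine (isConnected_compl_singleton_of_one_lt_rank ?_ x).image F hF.continuousOn
  rw [rank_prod']
  simp [one_add_one_eq_two]

theorem hasConesWithoutCutPoints_of_lattice
    (hc : ∀ x y, dist x y = |((c x).1 - (c y).1 : ℝ)| + |((c x).2 - (c y).2 : ℝ)|) :
    HasConesWithoutCutPoints X := by
  have hd : Tendsto (fun i : ℕ => (i : ℝ≥0) + 1) (hyperfilter ℕ : Filter ℕ) atTop :=
    (tendsto_atTop_mono (fun _ => le_self_add) tendsto_natCast_atTop_atTop).mono_left
      Nat.hyperfilter_le_atTop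
  have hpos : ∀ i : ℕ, 0 < (i : ℝ≥0) + 1 := fun i => by positivity
  exact ⟨hyperfilter ℕ, fun i => (i : ℝ≥0) + 1, hyperfilter_le_cofinite, hpos, hd,
    fun b p => not_isCutPoint_of_lattice hc hd hpos b p⟩

end Lattice

/-! ### The word metric of a free abelian group of rank two -/

section FreeAbelian

universe v

variable {H : Type v} [Group H]

/-- The preimage of the standard generating set of `ℤ × ℤ`. -/
def latticeGenerators (e : H ≃* Multiplicative (ℤ × ℤ)) : Set H :=
  {e.symm (Multiplicative.ofAdd (1, 0)), e.symm (Multiplicative.ofAdd (0, 1))}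

theorem eq_zpow_mul_zpow (e : H ≃* Multiplicative (ℤ × ℤ)) (h : H) :
    h = e.symm (Multiplicative.ofAdd (1, 0)) ^ (e h).toAdd.1 *
    e.symm (Multiplicative.ofAdd (0, 1)) ^ (e h).toAdd.2 := by
  apply e.injective
  apply Multiplicative.toAdd.injective
  simp

theorem closure_latticeGenerators (e : H ≃* Multiplicative (ℤ × ℤ)) :
    Subgroup.closure (latticeGenerators e) = ⊤ := by
  rw [eq_top_iff]
  intro h _
  rw [eq_zpow_mul_zpow e h]
  exact Subgroup.mul_mem _ (Subgroup.zpow_mem _ (mem_closure_pair_left _ _) _)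
    (Subgroup.zpow_mem _ (mem_closure_pair_right _ _) _)

/-- Each letter of a word changes the `ℓ¹` norm by at most `1`, and the word `x ^ a * y ^ b` attains
the bound. -/
theorem wordNorm_latticeGenerators (e : H ≃* Multiplicative (ℤ × ℤ)) (h : H) :
    wordNorm (latticeGenerators e) h = (e h).toAdd.1.natAbs + (e h).toAdd.2.natAbs := by
  have hS := closure_latticeGenerators e
  have hgen : ∀ g ∈ latticeGenerators e, wordNorm (latticeGenerators e) g ≤ 1 := by
    intro g hg
    simpa using wordNorm_prod_le (S := latticeGenerators e) (w := [g]) (by simp [hg])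
  apply le_antisymm
  · have h1 := hgen _ (Or.inl rfl)
    have h2 := hgen _ (Or.inr rfl)
    conv_lhs => rw [eq_zpow_mul_zpow e h]
    refine (wordNorm_mul_le hS _ _).trans (Nat.add_le_add ?_ ?_)
    · exact (wordNorm_zpow_le hS _ _).trans (by simpa using Nat.mul_le_mul_left _ h1)
    · exact (wordNorm_zpow_le hS _ _).trans (by simpa using Nat.mul_le_mul_left _ h2)
  · obtain ⟨w, hw, rfl, hl⟩ := exists_word hS h
    rw [← hl]
    clear hl
    induction w with
    | nil => simp
    | cons x w ih =>
      have h1 := ih fun y hy => hw y (List.mem_cons_of_mem x hy)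
      have h2 : (e x).toAdd.1.natAbs + (e x).toAdd.2.natAbs ≤ 1 := by
        have key : ∀ g ∈ latticeGenerators e,
            (e g).toAdd.1.natAbs + (e g).toAdd.2.natAbs ≤ 1 := by
          rintro g (rfl | rfl) <;> simp
        rcases hw x List.mem_cons_self with hx | hx
        · exact key x hx
        · simpa using key _ hx
      simp only [List.prod_cons, map_mul, toAdd_mul, Prod.fst_add, Prod.snd_add, List.length_cons]
      omega

theorem isUnconstrictedGroup_of_mulEquiv (e : H ≃* Multiplicative (ℤ × ℤ)) :
    IsUnconstrictedGroup H := by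
  refine ⟨latticeGenerators e, closure_latticeGenerators e, by simp [latticeGenerators], ?_⟩
  let := wordMetricSpace (latticeGenerators e) (closure_latticeGenerators e)
  have hc : ∀ x y : H, dist x y =
      |(((e.toEquiv.trans Multiplicative.toAdd) x).1 -
        ((e.toEquiv.trans Multiplicative.toAdd) y).1 : ℝ)| +
      |(((e.toEquiv.trans Multiplicative.toAdd) x).2 -
        ((e.toEquiv.trans Multiplicative.toAdd) y).2 : ℝ)| := by
    intro x y
    change (wordNorm (latticeGenerators e) (x⁻¹ * y) : ℝ) = _
    rw [wordNorm_latticeGenerators, Nat.cast_add, Nat.cast_natAbs, Nat.cast_natAbs]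
    simp only [map_mul, map_inv, toAdd_mul, toAdd_inv, Prod.fst_add, Prod.snd_add, Prod.fst_neg,
      Prod.snd_neg, Int.cast_abs, Int.cast_add, Int.cast_neg, Equiv.trans_apply,
      MulEquiv.toEquiv_eq_coe, MulEquiv.coe_toEquiv]
    rw [abs_sub_comm, abs_sub_comm (((e x).toAdd.2 : ℤ) : ℝ), neg_add_eq_sub, neg_add_eq_sub]
  exact ⟨hasConesWithoutCutPoints_of_lattice hc, nearBiinfiniteGeodesics_of_lattice hc⟩

end FreeAbelian

/-! ### Commuting elementary moves -/

theorem MulAut.zpow_apply_eq_self {G : Type*} [Group G] {τ : MulAut G} {h : G} (hh : τ h = h)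
    (k : ℤ) : (τ ^ k) h = h :=
  (MulAction.stabilizer (MulAut G) h).zpow_mem hh k

theorem MulAut.zpow_apply_eq_mul_zpow {G : Type*} [Group G] {τ : MulAut G} {g h : G}
    (hg : τ g = g * h) (hh : τ h = h) (k : ℤ) : (τ ^ k) g = g * h ^ k := by
  have key : ∀ m : ℕ, (τ ^ m) g = g * h ^ m := by
    intro m
    induction m with
    | zero => simp
    | succ m ih =>
      have hm : (τ ^ m) h = h := by simpa using MulAut.zpow_apply_eq_self hh m
      rw [pow_succ, MulAut.mul_apply, hg, _root_.map_mul, ih, hm, pow_succ, mul_assoc]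
  obtain ⟨m, rfl | rfl⟩ := k.eq_nat_or_neg
  · simpa using key m
  · apply (τ ^ (m : ℤ)).injective
    rw [← MulAut.mul_apply, ← zpow_add, add_neg_cancel, zpow_zero, _root_.map_mul, map_zpow,
      MulAut.zpow_apply_eq_self hh, zpow_natCast, key]
    simp

namespace FreeGroup

section Moves

variable {α : Type*}

theorem IsElementaryMove.apply_invLetter {τ : MulAut (FreeGroup α)} {a v : α × Bool}
    (h : IsElementaryMove τ a v) : τ (mk [invLetter a]) = mk [invLetter a] * mk [v] := by
  rw [h.apply_inv, mul_inv_rev, inv_inv, mk_invLetter]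

theorem IsElementaryMove.zpow_apply_invLetter {τ : MulAut (FreeGroup α)} {a v : α × Bool}
    (h : IsElementaryMove τ a v) (hav : v.1 ≠ a.1) (k : ℤ) :
    (τ ^ k) (mk [invLetter a]) = mk [invLetter a] * mk [v] ^ k :=
  MulAut.zpow_apply_eq_mul_zpow h.apply_invLetter (h.apply_of_ne hav) k

theorem IsElementaryMove.zpow_apply {τ : MulAut (FreeGroup α)} {a v : α × Bool}
    (h : IsElementaryMove τ a v) (hav : v.1 ≠ a.1) (k : ℤ) :
    (τ ^ k) (mk [a]) = (mk [v] ^ k)⁻¹ * mk [a] := by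
  rw [← inv_inj, ← _root_.map_inv, ← mk_invLetter a, h.zpow_apply_invLetter hav, mul_inv_rev,
    inv_inv, mk_invLetter]

theorem IsElementaryMove.zpow_apply_of_ne {τ : MulAut (FreeGroup α)} {a v l : α × Bool}
    (h : IsElementaryMove τ a v) (hl : l.1 ≠ a.1) (k : ℤ) : (τ ^ k) (mk [l]) = mk [l] :=
  MulAut.zpow_apply_eq_self (h.apply_of_ne hl) k

theorem mulAut_ext {φ ψ : MulAut (FreeGroup α)}
    (h : ∀ i, ∃ l : α × Bool, l.1 = i ∧ φ (mk [l]) = ψ (mk [l])) : φ = ψ := by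
  apply MulEquiv.toMonoidHom_injective
  ext i
  obtain ⟨⟨_, b⟩, rfl, hl⟩ := h i
  cases b
  · rw [mk_singleton] at hl
    simpa using hl
  · exact hl

theorem IsElementaryMove.commute {φ ψ : MulAut (FreeGroup α)} {a s b t : α × Bool}
    (hφ : IsElementaryMove φ a s) (hψ : IsElementaryMove ψ b t) (hab : a.1 ≠ b.1) (hsb : s.1 ≠ b.1)
    (hta : t.1 ≠ a.1) : Commute φ ψ := by
  refine mulAut_ext fun i => ?_
  by_cases hia : i = a.1
  · refine ⟨invLetter a, hia.symm, ?_⟩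
    rw [MulAut.mul_apply, MulAut.mul_apply, hψ.apply_of_ne (l := invLetter a) hab,
      hφ.apply_invLetter, _root_.map_mul, hψ.apply_of_ne (l := invLetter a) hab,
      hψ.apply_of_ne hsb]
  by_cases hib : i = b.1
  · refine ⟨invLetter b, hib.symm, ?_⟩
    rw [MulAut.mul_apply, MulAut.mul_apply, hφ.apply_of_ne (l := invLetter b) hab.symm,
      hψ.apply_invLetter, _root_.map_mul, hφ.apply_of_ne (l := invLetter b) hab.symm,
      hφ.apply_of_ne hta]
  · refine ⟨(i, true), rfl, ?_⟩
    rw [MulAut.mul_apply, MulAut.mul_apply, hφ.apply_of_ne (l := (i, true)) hia,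
      hψ.apply_of_ne (l := (i, true)) hib, hφ.apply_of_ne (l := (i, true)) hia]

/-- The two moves multiply the same generator on opposite sides, and each fixes the other's
multiplier. -/
theorem IsElementaryMove.commute_invLetter {φ ψ : MulAut (FreeGroup α)} {a s t : α × Bool}
    (hφ : IsElementaryMove φ a s) (hψ : IsElementaryMove ψ (invLetter a) t) (hsa : s.1 ≠ a.1)
    (hta : t.1 ≠ a.1) : Commute φ ψ := by
  refine mulAut_ext fun i => ?_
  by_cases hia : i = a.1
  · refine ⟨invLetter a, hia.symm, ?_⟩
    rw [MulAut.mul_apply, MulAut.mul_apply, hψ.1, hφ.apply_invLetter, _root_.map_mul,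
      _root_.map_mul, _root_.map_inv, hφ.apply_invLetter, hψ.1, hφ.apply_of_ne hta,
      hψ.apply_of_ne hsa, mul_assoc]
  · refine ⟨(i, true), rfl, ?_⟩
    rw [MulAut.mul_apply, MulAut.mul_apply, hφ.apply_of_ne (l := (i, true)) hia,
      hψ.apply_of_ne (l := (i, true)) hia, hφ.apply_of_ne (l := (i, true)) hia]

/-- The letter of which the powers `l ^ k` consist. -/
def signedLetter (l : α × Bool) (k : ℤ) : α × Bool := if 0 ≤ k then l else invLetter l

@[simp]
theorem signedLetter_fst (l : α × Bool) (k : ℤ) : (signedLetter l k).1 = l.1 := by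
  rw [signedLetter]
  split_ifs <;> rfl

theorem mk_singleton_zpow (l : α × Bool) (k : ℤ) :
    mk [l] ^ k = mk (List.replicate k.natAbs (signedLetter l k)) := by
  have key : ∀ (a : α × Bool) (m : ℕ), mk [a] ^ m = mk (List.replicate m a) := by
    intro a m
    rw [pow_mk]
    simp
  rw [signedLetter]
  split_ifs with h
  · obtain ⟨m, rfl⟩ := Int.eq_ofNat_of_zero_le h
    simp
  · obtain ⟨m, rfl⟩ : ∃ m : ℕ, k = -m := ⟨k.natAbs, by omega⟩
    rw [zpow_neg, ← inv_zpow, ← mk_invLetter, zpow_natCast, key, Int.natAbs_neg, Int.natAbs_natCast]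

theorem isReduced_replicate (m : ℕ) (l : α × Bool) : IsReduced (List.replicate m l) :=
  List.isChain_replicate_of_rel m fun _ => rfl

/-- The separators `x` and `y` keep the two powers apart, so `s` and `t` may belong to the same
generator. That `x` and `y` differ matters when an exponent is `0`. -/
theorem isCyclicallyReduced_of_four {x y s t : α × Bool} (hxs : x.1 ≠ s.1) (hxt : x.1 ≠ t.1)
    (hys : y.1 ≠ s.1) (hyt : y.1 ≠ t.1) (hxy : x.1 ≠ y.1) (m k : ℕ) :
    IsCyclicallyReduced ([x] ++ List.replicate m s ++ [y] ++ List.replicate k t) := by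
  rw [isCyclicallyReduced_iff]
  simp only [isReduced_append_iff, isReduced_replicate]
  rcases m with _ | m <;> rcases k with _ | k <;>
    simp [hxs, hyt, hxy, hxt.symm, hys.symm, hxy.symm,
      List.getLast?_replicate, List.head?_replicate, List.getLast?_append, List.getLast?_cons]

theorem isCyclicallyReduced_of_three {x s t : α × Bool} (hxs : x.1 ≠ s.1) (hxt : x.1 ≠ t.1)
    (hst : s.1 ≠ t.1) (m k : ℕ) :
    IsCyclicallyReduced ([x] ++ List.replicate m s ++ List.replicate k t) := by
  rw [isCyclicallyReduced_iff]
  simp only [isReduced_append_iff, isReduced_replicate]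
  rcases m with _ | m <;> rcases k with _ | k <;>
    simp [hxs, hxt, hst, hxs.symm, hxt.symm,
      List.getLast?_replicate, List.head?_replicate, List.getLast?_append, List.getLast?_cons]

variable [Finite α]

theorem isUndistortedPair_mk {φ ψ : MulAut (FreeGroup α)} (hc : Commute φ ψ) (w : FreeGroup α)
    (h : ∀ a b : ℤ, ∃ (u : FreeGroup α) (W : List (α × Bool)) (s t : α × Bool),
      (φ ^ a * ψ ^ b) w = u * mk W * u⁻¹ ∧ IsCyclicallyReduced W ∧ W ≠ [] ∧
        List.replicate a.natAbs s <:+: W ∧ List.replicate b.natAbs t <:+: W) :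
    IsUndistortedPair (QuotientGroup.mk' (Inn (FreeGroup α)) φ)
      (QuotientGroup.mk' (Inn (FreeGroup α)) ψ) where
  commute := hc.map _
  linear_growth S hS hS' := by
    classical
    obtain ⟨B, hB⟩ := exists_power_le_wordNorm hS hS'
    refine ⟨4 * B + 4 * norm w + 2, fun a b => ?_⟩
    obtain ⟨u, W, s, t, h1, h2, h3, h4, h5⟩ := h a b
    have e1 := hB _ _ _ _ _ _ h1 h2 h3 h4
    have e2 := hB _ _ _ _ _ _ h1 h2 h3 h5
    rw [← map_zpow, ← map_zpow, ← _root_.map_mul, QuotientGroup.mk'_apply]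
    set N := wordNorm S (QuotientGroup.mk (φ ^ a * ψ ^ b) : Out (FreeGroup α))
    -- Each exponent is at most `2 * (N * B + norm w) + 1`, the `1` coming from the rounded halving.
    have e3 : a.natAbs + b.natAbs ≤ 4 * (N * B + norm w) + 2 := by omega
    refine e3.trans ?_
    nlinarith [Nat.zero_le (N * norm w), Nat.zero_le N, Nat.zero_le B]

theorem IsElementaryMove.isUndistortedPair {φ ψ : MulAut (FreeGroup α)} {a s b t : α × Bool}
    (hφ : IsElementaryMove φ a s) (hψ : IsElementaryMove ψ b t) (hab : a.1 ≠ b.1) (hsb : s.1 ≠ b.1)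
    (hta : t.1 ≠ a.1) (hsa : s.1 ≠ a.1) (htb : t.1 ≠ b.1) :
    IsUndistortedPair (QuotientGroup.mk' (Inn (FreeGroup α)) φ)
      (QuotientGroup.mk' (Inn (FreeGroup α)) ψ) := by
  refine isUndistortedPair_mk (hφ.commute hψ hab hsb hta)
    (mk [invLetter a] * mk [invLetter b]) fun i j => ?_
  refine ⟨1, [invLetter a] ++ List.replicate i.natAbs (signedLetter s i) ++ [invLetter b] ++
    List.replicate j.natAbs (signedLetter t j), signedLetter s i, signedLetter t j, ?_, ?_, by simp,
    ⟨[invLetter a], [invLetter b] ++ List.replicate j.natAbs (signedLetter t j), by simp⟩,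
    (List.suffix_append _ _).isInfix⟩
  · rw [_root_.map_mul, MulAut.mul_apply, MulAut.mul_apply,
      hψ.zpow_apply_of_ne (l := invLetter a) hab, hψ.zpow_apply_invLetter htb, _root_.map_mul,
      hφ.zpow_apply_of_ne (l := invLetter b) hab.symm, map_zpow, hφ.zpow_apply_of_ne hta,
      hφ.zpow_apply_invLetter hsa, mk_singleton_zpow, mk_singleton_zpow, ← mul_mk, ← mul_mk,
      ← mul_mk]
    simp only [one_mul, inv_one, mul_one, mul_assoc]
  · refine isCyclicallyReduced_of_four ?_ ?_ ?_ ?_ ?_ _ _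
    exacts [by simpa using hsa.symm, by simpa using hta.symm, by simpa using hsb.symm,
      by simpa using htb.symm, by simpa using hab]

/-- Up to conjugacy `a⁻¹` goes to `a⁻¹ s ^ i t ^ (-j)`, which is cyclically reduced if `s` and `t`
belong to different generators. If they do not, the powers may merge, and a third generator `y` is
put between them. In rank two this fails: there `r_i⁻¹ l_i` is inner. -/
theorem IsElementaryMove.isUndistortedPair_invLetter {φ ψ : MulAut (FreeGroup α)}
    {a s t : α × Bool} (hφ : IsElementaryMove φ a s) (hψ : IsElementaryMove ψ (invLetter a) t)
    (hsa : s.1 ≠ a.1) (hta : t.1 ≠ a.1) (hst : s.1 ≠ t.1 ∨ ∃ i, i ≠ a.1 ∧ i ≠ s.1 ∧ i ≠ t.1) :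
    IsUndistortedPair (QuotientGroup.mk' (Inn (FreeGroup α)) φ)
      (QuotientGroup.mk' (Inn (FreeGroup α)) ψ) := by
  have hc := hφ.commute_invLetter hψ hsa hta
  have hx : ∀ i j : ℤ, (φ ^ i * ψ ^ j) (mk [invLetter a]) =
      mk [t] ^ (-j) * mk [invLetter a] * mk [s] ^ i := by
    intro i j
    rw [MulAut.mul_apply, hψ.zpow_apply hta, _root_.map_mul, _root_.map_inv, map_zpow,
      hφ.zpow_apply_of_ne hta, hφ.zpow_apply_invLetter hsa, zpow_neg, mul_assoc]
  rcases hst with hst | ⟨y, hya, hys, hyt⟩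
  · refine isUndistortedPair_mk hc (mk [invLetter a]) fun i j => ?_
    refine ⟨mk [t] ^ (-j), [invLetter a] ++ List.replicate i.natAbs (signedLetter s i) ++
      List.replicate (-j).natAbs (signedLetter t (-j)), signedLetter s i, signedLetter t (-j), ?_, ?_,
      by simp, List.infix_append _ _ _, ?_⟩
    · rw [hx, ← mul_mk, ← mul_mk, ← mk_singleton_zpow, ← mk_singleton_zpow]
      group
    · refine isCyclicallyReduced_of_three ?_ ?_ ?_ _ _
      exacts [by simpa using hsa.symm, by simpa using hta.symm, by simpa using hst]
    · rw [Int.natAbs_neg]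
      exact (List.suffix_append _ _).isInfix
  · refine isUndistortedPair_mk hc (mk [invLetter a] * mk [(y, true)]) fun i j => ?_
    refine ⟨mk [t] ^ (-j), [invLetter a] ++ List.replicate i.natAbs (signedLetter s i) ++
      [(y, true)] ++ List.replicate (-j).natAbs (signedLetter t (-j)), signedLetter s i,
      signedLetter t (-j), ?_, ?_, by simp, ⟨[invLetter a], [(y, true)] ++
        List.replicate (-j).natAbs (signedLetter t (-j)), by simp⟩, ?_⟩
    · have hy : (φ ^ i * ψ ^ j) (mk [(y, true)]) = mk [(y, true)] := by
        rw [MulAut.mul_apply, hψ.zpow_apply_of_ne (l := (y, true)) hya,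
          hφ.zpow_apply_of_ne (l := (y, true)) hya]
      rw [_root_.map_mul, hx, hy, ← mul_mk, ← mul_mk, ← mul_mk, ← mk_singleton_zpow,
        ← mk_singleton_zpow]
      group
    · refine isCyclicallyReduced_of_four ?_ ?_ ?_ ?_ ?_ _ _
      exacts [by simpa using hsa.symm, by simpa using hta.symm, by simpa using hys,
        by simpa using hyt, by simpa using hya.symm]
    · rw [Int.natAbs_neg]
      exact (List.suffix_append _ _).isInfix

end Moves

end FreeGroup

/-! ### Thickness from pairs of commuting elements -/

section Chains

variable {α : Type*}

/-- Two pairs have a common member. -/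
def ShareMember (p q : α × α) : Prop := p.1 = q.1 ∨ p.1 = q.2 ∨ p.2 = q.1 ∨ p.2 = q.2

theorem ShareMember.symm {p q : α × α} (h : ShareMember p q) : ShareMember q p := by
  rcases h with h | h | h | h <;> simp [ShareMember, h]

/-- Consecutive members of chains of pairs in `P`. -/
def IsChainStep (P : Set (α × α)) (p q : α × α) : Prop := p ∈ P ∧ q ∈ P ∧ ShareMember p q

end Chains

/-! ### The reduction of thickness to chains of pairs -/

section ThickPairs

universe v

variable {G : Type v} [Group G]

theorem finiteIndex_of_mul_finite {K : Subgroup G} {W : Set G} (hW : W.Finite)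
    (h : ∀ g : G, ∃ τ ∈ K, ∃ σ ∈ W, g = τ * σ) : K.FiniteIndex := by
  have : Finite (G ⧸ K) := by
    refine Set.finite_univ_iff.1 ((hW.image fun σ => (QuotientGroup.mk σ⁻¹ : G ⧸ K)).subset ?_)
    intro q _
    obtain ⟨g, rfl⟩ := QuotientGroup.mk_surjective q
    -- The factorization is applied to `g⁻¹` because the quotient consists of left cosets.
    obtain ⟨τ, hτ, σ, hσ, hg⟩ := h g⁻¹
    refine ⟨σ, hσ, QuotientGroup.eq.2 ?_⟩
    rw [← inv_inv g, hg]
    simpa using K.inv_mem hτ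
  exact Subgroup.finiteIndex_of_finite_quotient

theorem fg_of_mul_finite {T W : Set G} (hT : T.Finite) (hW : W.Finite)
    (h : ∀ g : G, ∃ τ ∈ Subgroup.closure T, ∃ σ ∈ W, g = τ * σ) : Group.FG G := by
  rw [Group.fg_iff]
  refine ⟨T ∪ W, ?_, hT.union hW⟩
  rw [eq_top_iff]
  intro g _
  obtain ⟨τ, hτ, σ, hσ, rfl⟩ := h g
  exact Subgroup.mul_mem _ (Subgroup.closure_mono Set.subset_union_left hτ)
    (Subgroup.subset_closure (Or.inr hσ))

/-- The subgroup generated by a pair. -/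
def pairSubgroup (p : G × G) : Subgroup G := Subgroup.closure {p.1, p.2}

theorem infinite_inf_of_shareMember [Group.FG G] {p q : G × G} (hp : IsUndistortedPair p.1 p.2)
    (h : ShareMember p q) : ((pairSubgroup p ⊓ pairSubgroup q : Subgroup G) : Set G).Infinite := by
  have key : ∀ x : G, (Subgroup.zpowers x : Set G).Infinite → x ∈ pairSubgroup p →
      x ∈ pairSubgroup q → ((pairSubgroup p ⊓ pairSubgroup q : Subgroup G) : Set G).Infinite := by
    intro x hx h1 h2
    refine hx.mono ?_
    rw [SetLike.coe_subset_coe, Subgroup.zpowers_le]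
    exact ⟨h1, h2⟩
  rcases h with h | h | h | h
  · exact key p.1 hp.infinite_zpowers (mem_closure_pair_left _ _) (h ▸ mem_closure_pair_left _ _)
  · exact key p.1 hp.infinite_zpowers (mem_closure_pair_left _ _) (h ▸ mem_closure_pair_right _ _)
  · exact key p.2 hp.symm.infinite_zpowers (mem_closure_pair_right _ _)
      (h ▸ mem_closure_pair_left _ _)
  · exact key p.2 hp.symm.infinite_zpowers (mem_closure_pair_right _ _)
      (h ▸ mem_closure_pair_right _ _)

theorem algThick_of_pairs {P : Set (G × G)} (hP : P.Finite) (hne : P.Nonempty)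
    (hU : ∀ p ∈ P, IsUndistortedPair p.1 p.2)
    (hconn : ∀ p ∈ P, ∀ q ∈ P, Relation.ReflTransGen (IsChainStep P) p q)
    {T W : Set G} (hT : T.Finite) (hTP : ∀ x ∈ T, ∃ p ∈ P, x = p.1 ∨ x = p.2) (hW : W.Finite)
    (h : ∀ g : G, ∃ τ ∈ Subgroup.closure T, ∃ σ ∈ W, g = τ * σ)
    {S : Set G} (hS : S.Finite) (hS' : Subgroup.closure S = ⊤) :
    ∃ M : ℝ, 0 < M ∧ AlgThickSuccWithRespectTo 0 S M (pairSubgroup '' P) := by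
  have := fg_of_mul_finite hT hW h
  obtain ⟨C, hC⟩ := (hW.image fun σ => wordNorm S σ).bddAbove
  -- For `g = τ σ` the distance from `g` to `τ` is the norm of `σ`, at most `C`; the `1` makes the
  -- inequality strict.
  refine ⟨C + 1, by positivity, ⟨hS, hS', by positivity, hP.image _, hne.image _, ?_, ?_, ?_⟩, ?_⟩
  · rintro _ ⟨p, hp, rfl⟩
    exact ⟨(Subgroup.fg_iff _).2 ⟨{p.1, p.2}, rfl, by simp⟩, (hU p hp).isUndistorted⟩
  · refine ⟨Subgroup.closure T, finiteIndex_of_mul_finite hW h, fun g => ?_, T, hT, rfl, ?_⟩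
    · obtain ⟨τ, hτ, σ, hσ, hg⟩ := h g
      refine ⟨τ, hτ, ?_⟩
      have h1 : g⁻¹ * τ = σ⁻¹ := by rw [hg]; group
      rw [h1, wordNorm_inv hS']
      have h2 : wordNorm S σ ≤ C := hC ⟨σ, hσ, rfl⟩
      exact_mod_cast Nat.lt_succ_of_le h2
    · intro x hx
      obtain ⟨p, hp, hxp⟩ := hTP x hx
      refine Set.mem_biUnion (Set.mem_image_of_mem _ hp) ?_
      rcases hxp with rfl | rfl
      · exact mem_closure_pair_left _ _
      · exact mem_closure_pair_right _ _
  · rintro _ ⟨p, hp, rfl⟩ _ ⟨q, hq, rfl⟩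
    refine Relation.ReflTransGen.lift pairSubgroup ?_ _ _ (hconn p hp q hq)
    rintro a b ⟨ha, hb, hab⟩
    exact ⟨⟨a, ha, rfl⟩, ⟨b, hb, rfl⟩, infinite_inf_of_shareMember (hU a ha) hab⟩
  · rintro _ ⟨p, hp, rfl⟩
    obtain ⟨e⟩ := (hU p hp).nonempty_mulEquiv
    exact isUnconstrictedGroup_of_mulEquiv e

/-- Chains of pairs are mapped to chains by homomorphisms. -/
theorem reflTransGen_map {H : Type*} [Group H] (f : G →* H) {P : Set (G × G)} {p q : G × G}
    (h : Relation.ReflTransGen (IsChainStep P) p q) :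
    Relation.ReflTransGen (IsChainStep (Prod.map f f '' P)) (Prod.map f f p) (Prod.map f f q) := by
  refine Relation.ReflTransGen.lift (Prod.map f f) ?_ _ _ h
  rintro a b ⟨ha, hb, hab⟩
  refine ⟨⟨a, ha, rfl⟩, ⟨b, hb, rfl⟩, ?_⟩
  rcases hab with h | h | h | h <;> simp [ShareMember, h]

theorem map_pairSubgroup {H : Type*} [Group H] (f : G →* H) (p : G × G) :
    (pairSubgroup p).map f = pairSubgroup (Prod.map f f p) := by
  rw [pairSubgroup, pairSubgroup, MonoidHom.map_closure, Set.image_pair]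
  rfl

theorem exists_mul_of_surjective {H : Type*} [Group H] {f : G →* H} (hf : Function.Surjective f)
    {T W : Set G} (h : ∀ g : G, ∃ τ ∈ Subgroup.closure T, ∃ σ ∈ W, g = τ * σ) (x : H) :
    ∃ τ ∈ Subgroup.closure (f '' T), ∃ σ ∈ f '' W, x = τ * σ := by
  obtain ⟨g, rfl⟩ := hf x
  obtain ⟨τ, hτ, σ, hσ, rfl⟩ := h g
  refine ⟨f τ, ?_, f σ, ⟨σ, hσ, rfl⟩, map_mul f τ σ⟩
  rw [← MonoidHom.map_closure]
  exact ⟨τ, hτ, rfl⟩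

end ThickPairs

/-! ### The transvections of a free group -/

namespace FreeGroup

section Transvections

variable {α : Type*}

theorem IsElementaryMove.inv {τ : MulAut (FreeGroup α)} {a v : α × Bool}
    (h : IsElementaryMove τ a v) (hav : v.1 ≠ a.1) : IsElementaryMove τ⁻¹ a (invLetter v) := by
  constructor
  · have := h.zpow_apply hav (-1)
    rw [mk_invLetter]
    simpa only [zpow_neg, zpow_one] using this
  · intro i hi
    exact (MulEquiv.symm_apply_eq τ).2 (h.2 i hi).symm

/-- As `φ` sends `a` to `v⁻¹ a` and `ψ` sends `v` to `v s`, the letter `a` travels through `v⁻¹ a`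
and `s⁻¹ v⁻¹ a` to `s⁻¹ a`. This composes moves along neighbouring generators into moves between
distant ones. -/
theorem IsElementaryMove.commutator {φ ψ : MulAut (FreeGroup α)} {a v s : α × Bool}
    (hφ : IsElementaryMove φ a v) (hψ : IsElementaryMove ψ (invLetter v) s) (hva : v.1 ≠ a.1)
    (hsv : s.1 ≠ v.1) (hsa : s.1 ≠ a.1) : IsElementaryMove (φ⁻¹ * ψ * φ * ψ⁻¹) a s := by
  have hφ' := hφ.inv hva
  have hψ' := hψ.inv hsv
  have hψv : ψ (mk [v]) = mk [v] * mk [s] := by simpa using! hψ.apply_invLetter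
  have hψv' : ψ⁻¹ (mk [v]) = mk [v] * (mk [s])⁻¹ := by
    refine (MulEquiv.symm_apply_eq ψ).2 ?_
    rw [_root_.map_mul, hψv, _root_.map_inv, hψ.apply_of_ne hsv,
      mul_inv_cancel_right]
  constructor
  · simp only [MulAut.mul_apply]
    rw [hψ'.apply_of_ne hva.symm, hφ.1, _root_.map_mul, _root_.map_inv, hψv,
      hψ.apply_of_ne (l := a) hva.symm, _root_.map_mul, _root_.map_inv, _root_.map_mul,
      hφ'.apply_of_ne hva, hφ'.apply_of_ne hsa, hφ'.1, mk_invLetter]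
    group
  · intro i hi
    simp only [MulAut.mul_apply]
    by_cases hiv : i = v.1
    · have key : φ⁻¹ (ψ (φ (ψ⁻¹ (mk [v])))) = mk [v] := by
        rw [hψv', _root_.map_mul, _root_.map_inv, hφ.apply_of_ne hva, hφ.apply_of_ne hsa,
          _root_.map_mul, _root_.map_inv, hψv, hψ.apply_of_ne hsv, mul_inv_cancel_right,
          hφ'.apply_of_ne hva]
      rw [mk_singleton, ← hiv] at key
      split_ifs at key
      · exact key
      · simpa only [_root_.map_inv, inv_inj] using key
    · rw [hψ'.2 i hiv, hφ.2 i hi, hψ.2 i hiv, hφ'.2 i hi]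

variable [DecidableEq α]

theorem isElementaryMove_rightTransvection {a b : α} (h : b ≠ a) :
    IsElementaryMove (rightTransvection a b h) (a, false) (b, true) := by
  have ha : rightTransvection a b h (of a) = of a * of b := by
    change transvectionHom a 1 (of b) (of a) = _
    rw [transvectionHom_of_self, one_mul]
  refine ⟨?_, fun i hi => transvectionHom_of_ne hi _ _⟩
  rw [mk_singleton, mk_singleton]
  simp [ha]

theorem isElementaryMove_leftTransvection {a b : α} (h : b ≠ a) :
    IsElementaryMove (leftTransvection a b h) (a, true) (b, false) := by
  have ha : leftTransvection a b h (of a) = of b * of a := by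
    change transvectionHom a (of b) 1 (of a) = _
    rw [transvectionHom_of_self, mul_one]
  refine ⟨?_, fun i hi => transvectionHom_of_ne hi _ _⟩
  rw [mk_singleton, mk_singleton]
  simp [ha]

end Transvections

end FreeGroup

/-! ### The transvections `r_i`, `l_i`, `n_i` and their pairs -/

section Nielsen

open FreeGroup

variable {n : ℕ}

/-- The transvections `r_i` and `l_i`. -/
def nielsenGenerators (hn : 3 ≤ n) : Set (MulAut (FreeGrp n)) := 
  Set.range (nielsenR hn) ∪ Set.range (nielsenL hn)

theorem exists_isElementaryMove_one (hn : 3 ≤ n) (b : ZMod n) (ε : Bool) :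
    ∃ τ ∈ nielsenGenerators hn, IsElementaryMove τ (b + 1, ε) (b, !ε) := by
  cases ε
  · exact ⟨nielsenR hn b, Or.inl ⟨b, rfl⟩, isElementaryMove_rightTransvection _⟩
  · exact ⟨nielsenL hn b, Or.inr ⟨b, rfl⟩, isElementaryMove_leftTransvection _⟩

theorem add_natCast_ne_self {k : ℕ} (hk : 0 < k) (hkn : k < n) (b : ZMod n) : b + k ≠ b := by
  rw [Ne, add_eq_left, ZMod.natCast_eq_zero_iff]
  exact Nat.not_dvd_of_pos_of_lt hk hkn

/-- Going around the cycle, the move at distance `k + 2` is a commutator of the move at distance `k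
+ 1` with a neighbour move. The bound on `k` keeps the three generators distinct. -/
theorem exists_isElementaryMove_natCast (hn : 3 ≤ n) (b : ZMod n) (ε : Bool) (k : ℕ)
    (hk : k + 1 < n) :
    ∃ τ ∈ Subgroup.closure (nielsenGenerators hn),
      IsElementaryMove τ (b + (k + 1 : ℕ), ε) (b, !ε) := by
  induction k with
  | zero =>
    obtain ⟨τ, hτ, h⟩ := exists_isElementaryMove_one hn b ε
    exact ⟨τ, Subgroup.subset_closure hτ, by simpa using h⟩
  | succ k ih =>
    obtain ⟨ψ, hψ, h1⟩ := ih (by omega)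
    obtain ⟨φ, hφ, h2⟩ := exists_isElementaryMove_one hn (b + (k + 1 : ℕ)) ε
    replace hφ := Subgroup.subset_closure hφ
    refine ⟨φ⁻¹ * ψ * φ * ψ⁻¹, Subgroup.mul_mem _ (Subgroup.mul_mem _ (Subgroup.mul_mem _
      (Subgroup.inv_mem _ hφ) hψ) hφ) (Subgroup.inv_mem _ hψ), ?_⟩
    have e : b + ((k + 1 + 1 : ℕ) : ZMod n) = b + (k + 1 : ℕ) + 1 := by push_cast; ring
    rw [e]
    refine h2.commutator (by simpa [invLetter] using h1) (ne_add_one_zmod hn _) ?_ ?_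
    · exact (add_natCast_ne_self (by omega) (by omega) b).symm
    · rw [← e]
      exact (add_natCast_ne_self (by omega) hk b).symm

theorem exists_isElementaryMove (hn : 3 ≤ n) (a v : ZMod n × Bool) (h : a.1 ≠ v.1) :
    ∃ τ ∈ Subgroup.closure (nielsenGenerators hn), IsElementaryMove τ a v := by
  have : NeZero n := ⟨by omega⟩
  obtain ⟨p, ε⟩ := a
  obtain ⟨q, δ⟩ := v
  have hpos : (p - q).val ≠ 0 := by
    rw [Ne, ZMod.val_eq_zero, sub_eq_zero]
    exact h
  obtain ⟨k, hk⟩ := Nat.exists_eq_succ_of_ne_zero hpos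
  obtain ⟨τ, hτ, hm⟩ := exists_isElementaryMove_natCast hn q ε k
    (by have := ZMod.val_lt (p - q); omega)
  have hp : q + ((k + 1 : ℕ) : ZMod n) = p := by
    rw [← Nat.succ_eq_add_one, ← hk, ZMod.natCast_zmod_val]
    ring
  rw [hp] at hm
  -- The commutators yield only multipliers of sign `!ε`; inverses give the other sign.
  by_cases hδ : δ = !ε
  · subst hδ
    exact ⟨τ, hτ, hm⟩
  · refine ⟨τ⁻¹, Subgroup.inv_mem _ hτ, ?_⟩
    have := hm.inv h.symm
    rw [show δ = ε by cases δ <;> cases ε <;> simp_all]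
    simpa [invLetter] using this

theorem exists_mul_mem_closure_nielsenGenerators (hn : 3 ≤ n) (φ : MulAut (FreeGrp n)) :
    ∃ τ ∈ Subgroup.closure (nielsenGenerators hn), ∃ σ ∈ signedPerms (ZMod n), φ = τ * σ := by
  have : NeZero n := ⟨by omega⟩
  exact exists_mul_mem_signedPerms (exists_isElementaryMove hn) φ

/-- The pairs that generate the members of `nielsenFamily`. -/
def nielsenPairs (hn : 3 ≤ n) : Set (MulAut (FreeGrp n) × MulAut (FreeGrp n)) :=
  {p | ∃ i j : ZMod n, 2 ≤ cyclicDist i j ∧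
      p.1 ∈ ({nielsenR hn i, nielsenL hn i} : Set (MulAut (FreeGrp n))) ∧
      p.2 ∈ ({nielsenR hn j, nielsenL hn j} : Set (MulAut (FreeGrp n)))} ∪
  Set.range (fun i => (nielsenR hn i, nielsenL hn i)) ∪
  Set.range (fun i => (nielsenN hn i, nielsenR hn i)) ∪
  Set.range (fun i => (nielsenN hn i, nielsenL hn (i + 1)))

theorem image_pairSubgroup_nielsenPairs (hn : 3 ≤ n) :
    pairSubgroup '' nielsenPairs hn = nielsenFamily hn := by
  simp only [nielsenPairs, nielsenFamily, Set.image_union, ← Set.range_comp]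
  congr 1
  · congr 1
    · congr 1
      · ext H
        constructor
        · rintro ⟨⟨φ, ψ⟩, ⟨i, j, hij, hφ, hψ⟩, rfl⟩
          exact ⟨i, j, hij, φ, hφ, ψ, hψ, rfl⟩
        · rintro ⟨i, j, hij, φ, hφ, ψ, hψ, rfl⟩
          exact ⟨(φ, ψ), ⟨i, j, hij, hφ, hψ⟩, rfl⟩
      · ext H
        exact exists_congr fun i => eq_comm
    · ext H
      exact exists_congr fun i => eq_comm
  · ext H
    exact exists_congr fun i => eq_comm

theorem outNielsenFamily_eq (hn : 3 ≤ n) : outNielsenFamily hn =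
    pairSubgroup '' (Prod.map (QuotientGroup.mk' (Inn (FreeGrp n)))
      (QuotientGroup.mk' (Inn (FreeGrp n))) '' nielsenPairs hn) := by
  rw [outNielsenFamily, ← image_pairSubgroup_nielsenPairs, Set.image_image, Set.image_image]
  simp only [map_pairSubgroup]

theorem finite_nielsenGenerators (hn : 3 ≤ n) : (nielsenGenerators hn).Finite := by
  have : NeZero n := ⟨by omega⟩
  exact (Set.finite_range _).union (Set.finite_range _)

theorem finite_nielsenPairs (hn : 3 ≤ n) : (nielsenPairs hn).Finite := by
  have : NeZero n := ⟨by omega⟩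
  refine (((Set.Finite.subset ((finite_nielsenGenerators hn).prod
    (finite_nielsenGenerators hn)) ?_).union (Set.finite_range _)).union
    (Set.finite_range _)).union (Set.finite_range _)
  rintro ⟨φ, ψ⟩ ⟨i, j, -, hφ, hψ⟩
  constructor
  · rcases hφ with h | h
    exacts [Or.inl ⟨i, h.symm⟩, Or.inr ⟨i, h.symm⟩]
  · rcases hψ with h | h
    exacts [Or.inl ⟨j, h.symm⟩, Or.inr ⟨j, h.symm⟩]

theorem isElementaryMove_nielsenR (hn : 3 ≤ n) (i : ZMod n) :
    IsElementaryMove (nielsenR hn i) (i + 1, false) (i, true) :=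
  isElementaryMove_rightTransvection _

theorem isElementaryMove_nielsenL (hn : 3 ≤ n) (i : ZMod n) :
    IsElementaryMove (nielsenL hn i) (i + 1, true) (i, false) :=
  isElementaryMove_leftTransvection _

theorem isElementaryMove_nielsenN (hn : 3 ≤ n) (i : ZMod n) :
    IsElementaryMove (nielsenN hn i) (i + 2, false) (i, true) :=
  isElementaryMove_rightTransvection _

theorem cyclicDist_add_one_le (hn : 3 ≤ n) (i : ZMod n) : cyclicDist (i + 1) i ≤ 1 := by
  have : NeZero n := ⟨by omega⟩
  have : Fact (1 < n) := ⟨by omega⟩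
  rw [cyclicDist, add_sub_cancel_left, ZMod.valMinAbs_natAbs_eq_min, ZMod.val_one]
  exact min_le_left _ _

theorem cyclicDist_comm (i j : ZMod n) : cyclicDist i j = cyclicDist j i := by
  rw [cyclicDist, cyclicDist, ← ZMod.natAbs_valMinAbs_neg, neg_sub]

/-- The members of `{r_i, l_i}` are elementary moves of `x_{i+1}` by `x_i`. -/
theorem exists_isElementaryMove_of_mem (hn : 3 ≤ n) {i : ZMod n} {φ : MulAut (FreeGrp n)}
    (h : φ ∈ ({nielsenR hn i, nielsenL hn i} : Set (MulAut (FreeGrp n)))) :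
    ∃ ε δ : Bool, IsElementaryMove φ (i + 1, ε) (i, δ) := by
  rcases h with rfl | rfl
  · exact ⟨_, _, isElementaryMove_nielsenR hn i⟩
  · exact ⟨_, _, isElementaryMove_nielsenL hn i⟩

theorem isUndistortedPair_of_mem_nielsenPairs (hn : 3 ≤ n)
    {p : MulAut (FreeGrp n) × MulAut (FreeGrp n)}
    (hp : p ∈ nielsenPairs hn) :
    Commute p.1 p.2 ∧ IsUndistortedPair (QuotientGroup.mk' (Inn (FreeGrp n)) p.1)
      (QuotientGroup.mk' (Inn (FreeGrp n)) p.2) := by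
  have : NeZero n := ⟨by omega⟩
  have h1 := ne_add_one_zmod hn
  have h2 := ne_add_two_zmod hn
  have h12 : ∀ i : ZMod n, i + 1 ≠ i + 2 := by
    intro i h
    exact h1 (i + 1) (h.trans (by ring))
  rcases hp with ((⟨i, j, hij, hφ, hψ⟩ | ⟨i, rfl⟩) | ⟨i, rfl⟩) | ⟨i, rfl⟩
  · obtain ⟨ε, δ, hφ⟩ := exists_isElementaryMove_of_mem hn hφ
    obtain ⟨ε', δ', hψ⟩ := exists_isElementaryMove_of_mem hn hψ
    -- Cyclic distance at least `2` ensures that the moved generators differ and that neither move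
    -- changes the multiplier of the other.
    have e1 : i ≠ j := by
      rintro rfl
      simp [cyclicDist] at hij
    have e2 : i ≠ j + 1 := by
      rintro rfl
      have := cyclicDist_add_one_le hn j
      omega
    have e3 : j ≠ i + 1 := by
      rintro rfl
      have := cyclicDist_add_one_le hn i
      rw [cyclicDist_comm] at this
      omega
    have e4 : i + 1 ≠ j + 1 := fun h => e1 (add_right_cancel h)
    exact ⟨hφ.commute hψ e4 e2 e3, hφ.isUndistortedPair hψ e4 e2 e3 (h1 i) (h1 j)⟩
  · have hφ := isElementaryMove_nielsenR hn i
    have hψ := isElementaryMove_nielsenL hn i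
    exact ⟨hφ.commute_invLetter hψ (h1 i) (h1 i), hφ.isUndistortedPair_invLetter hψ (h1 i) (h1 i)
      -- Both multipliers are powers of `x_i`, so the third generator `x_{i+2}` serves as separator.
      (Or.inr ⟨i + 2, (h12 i).symm, (h2 i).symm, (h2 i).symm⟩)⟩
  · have hφ := isElementaryMove_nielsenN hn i
    have hψ := isElementaryMove_nielsenR hn i
    exact ⟨hφ.commute hψ (h12 i).symm (h1 i) (h2 i),
      hφ.isUndistortedPair hψ (h12 i).symm (h1 i) (h2 i) (h2 i) (h1 i)⟩
  · have hφ := isElementaryMove_nielsenN hn i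
    have hψ := isElementaryMove_nielsenL hn (i + 1)
    rw [show i + 1 + 1 = i + 2 by ring] at hψ
    exact ⟨hφ.commute_invLetter hψ (h2 i) (h12 i), hφ.isUndistortedPair_invLetter hψ (h2 i) (h12 i)
      (Or.inl (h1 i))⟩

theorem rl_mem_nielsenPairs (hn : 3 ≤ n) (i : ZMod n) :
    (nielsenR hn i, nielsenL hn i) ∈ nielsenPairs hn :=
  Or.inl (Or.inl (Or.inr ⟨i, rfl⟩))

/-- The step from `k` to `k + 1` passes through two pairs containing `n_k`; the shared members are
`r_k`, `n_k` and `l_{k+1}` in turn. -/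
theorem reflTransGen_rl_zero (hn : 3 ≤ n) (k : ℕ) :
    Relation.ReflTransGen (IsChainStep (nielsenPairs hn))
      (nielsenR hn 0, nielsenL hn 0) (nielsenR hn k, nielsenL hn k) := by
  induction k with
  | zero => rw [Nat.cast_zero]
  | succ k ih =>
    have hB : (nielsenN hn k, nielsenR hn k) ∈ nielsenPairs hn := Or.inl (Or.inr ⟨k, rfl⟩)
    have hC : (nielsenN hn k, nielsenL hn (k + 1)) ∈ nielsenPairs hn := Or.inr ⟨k, rfl⟩
    rw [Nat.cast_succ]
    refine ((ih.tail ⟨rl_mem_nielsenPairs hn k, hB, ?_⟩).tail ⟨hB, hC, ?_⟩).tail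
      ⟨hC, rl_mem_nielsenPairs hn (k + 1), ?_⟩ <;> simp [ShareMember]

theorem reflTransGen_nielsenPairs (hn : 3 ≤ n) {p q : MulAut (FreeGrp n) × MulAut (FreeGrp n)}
    (hp : p ∈ nielsenPairs hn) (hq : q ∈ nielsenPairs hn) :
    Relation.ReflTransGen (IsChainStep (nielsenPairs hn)) p q := by
  have : NeZero n := ⟨by omega⟩
  have hsymm : Std.Symm (IsChainStep (nielsenPairs hn)) :=
    ⟨fun a b h => ⟨h.2.1, h.1, h.2.2.symm⟩⟩
  have key : ∀ p ∈ nielsenPairs hn, Relation.ReflTransGen (IsChainStep (nielsenPairs hn))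
      (nielsenR hn 0, nielsenL hn 0) p := by
    intro p hp
    -- Every pair contains some `r_i` or `l_i`, hence is adjacent to the chain of the pairs `(r_i,
    -- l_i)`.
    have hi : ∃ i, ShareMember (nielsenR hn i, nielsenL hn i) p := by
      rcases hp with ((⟨i, j, hij, hφ | hφ, hψ⟩ | ⟨i, rfl⟩) | ⟨i, rfl⟩) | ⟨i, rfl⟩
      · exact ⟨i, Or.inl hφ.symm⟩
      · exact ⟨i, Or.inr (Or.inr (Or.inl hφ.symm))⟩
      · exact ⟨i, Or.inl rfl⟩
      · exact ⟨i, Or.inr (Or.inl rfl)⟩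
      · exact ⟨i + 1, Or.inr (Or.inr (Or.inr rfl))⟩
    obtain ⟨i, hi⟩ := hi
    have h0 := reflTransGen_rl_zero hn i.val
    rw [ZMod.natCast_zmod_val] at h0
    exact h0.tail ⟨rl_mem_nielsenPairs hn i, hp, hi⟩
  exact (Relation.ReflTransGen.stdSymm.symm _ _ (key p hp)).trans (key q hq)

theorem exists_mem_nielsenPairs (hn : 3 ≤ n) {x : MulAut (FreeGrp n)}
    (hx : x ∈ nielsenGenerators hn) :
    ∃ p ∈ nielsenPairs hn, x = p.1 ∨ x = p.2 := by
  rcases hx with ⟨i, rfl⟩ | ⟨i, rfl⟩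
  · exact ⟨_, rl_mem_nielsenPairs hn i, Or.inl rfl⟩
  · exact ⟨_, rl_mem_nielsenPairs hn i, Or.inr rfl⟩

end Nielsen

theorem mainTheorem5 (n : ℕ) (hn : 3 ≤ n) :
    -- both groups are algebraically thick of order at most one
    (AlgThickOfOrderAtMost 1 (MulAut (FreeGrp n)) ∧ AlgThickOfOrderAtMost 1 (Out (FreeGrp n))) ∧
    -- namely with respect to the explicit families, for every choice of the word metric
    (∀ S : Set (MulAut (FreeGrp n)), S.Finite → Subgroup.closure S = ⊤ →
      ∃ M : ℝ, 0 < M ∧ AlgThickSuccWithRespectTo 0 S M (nielsenFamily hn)) ∧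
    (∀ S : Set (Out (FreeGrp n)), S.Finite → Subgroup.closure S = ⊤ →
      ∃ M : ℝ, 0 < M ∧ AlgThickSuccWithRespectTo 0 S M (outNielsenFamily hn)) ∧
    -- whose members are free abelian of rank two
    (∀ H ∈ nielsenFamily hn, Nonempty (H ≃* Multiplicative (ℤ × ℤ))) ∧
    (∀ H ∈ outNielsenFamily hn, Nonempty (H ≃* Multiplicative (ℤ × ℤ))) := by
  have : NeZero n := ⟨by omega⟩
  let f := QuotientGroup.mk' (Inn (FreeGrp n))
  have hf : Function.Surjective f := QuotientGroup.mk'_surjective _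
  have hT := finite_nielsenGenerators hn
  have hW := FreeGroup.finite_signedPerms (ZMod n)
  have hfact := exists_mul_mem_closure_nielsenGenerators hn
  have hfact' := exists_mul_of_surjective hf hfact
  -- Undistortion in the automorphism group follows from that of the images; only commutation has to
  -- be known upstairs.
  have hU : ∀ p ∈ nielsenPairs hn, IsUndistortedPair p.1 p.2 := fun p hp =>
    .of_map hf (isUndistortedPair_of_mem_nielsenPairs hn hp).1
      (isUndistortedPair_of_mem_nielsenPairs hn hp).2
  have hU' : ∀ p ∈ Prod.map f f '' nielsenPairs hn, IsUndistortedPair p.1 p.2 := by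
    rintro _ ⟨p, hp, rfl⟩
    exact (isUndistortedPair_of_mem_nielsenPairs hn hp).2
  have hne : (nielsenPairs hn).Nonempty := ⟨_, rl_mem_nielsenPairs hn 0⟩
  have hAut : ∀ S : Set (MulAut (FreeGrp n)), S.Finite → Subgroup.closure S = ⊤ →
      ∃ M : ℝ, 0 < M ∧ AlgThickSuccWithRespectTo 0 S M (nielsenFamily hn) := by
    intro S hS hS'
    rw [← image_pairSubgroup_nielsenPairs]
    exact algThick_of_pairs (finite_nielsenPairs hn) hne hU
      (fun p hp q hq => reflTransGen_nielsenPairs hn hp hq) hT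
      (fun x hx => exists_mem_nielsenPairs hn hx) hW hfact hS hS'
  have hOut : ∀ S : Set (Out (FreeGrp n)), S.Finite → Subgroup.closure S = ⊤ →
      ∃ M : ℝ, 0 < M ∧ AlgThickSuccWithRespectTo 0 S M (outNielsenFamily hn) := by
    intro S hS hS'
    rw [outNielsenFamily_eq]
    refine algThick_of_pairs ((finite_nielsenPairs hn).image _) (hne.image _) hU' ?_ (hT.image f) ?_
      (hW.image f) hfact' hS hS'
    · rintro _ ⟨p, hp, rfl⟩ _ ⟨q, hq, rfl⟩
      exact reflTransGen_map f (reflTransGen_nielsenPairs hn hp hq)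
    · rintro _ ⟨x, hx, rfl⟩
      obtain ⟨p, hp, hxp⟩ := exists_mem_nielsenPairs hn hx
      exact ⟨_, ⟨p, hp, rfl⟩, hxp.imp (congrArg f) (congrArg f)⟩
  have hfg : Group.FG (MulAut (FreeGrp n)) := fg_of_mul_finite hT hW hfact
  have hfg' : Group.FG (Out (FreeGrp n)) := fg_of_mul_finite (hT.image f) (hW.image f) hfact'
  refine ⟨⟨?_, ?_⟩, hAut, hOut, ?_, ?_⟩
  · obtain ⟨S, hS, hS'⟩ := Group.fg_iff.1 hfg
    obtain ⟨M, -, hM⟩ := hAut S hS' hS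
    exact ⟨S, M, nielsenFamily hn, hM⟩
  · obtain ⟨S, hS, hS'⟩ := Group.fg_iff.1 hfg'
    obtain ⟨M, -, hM⟩ := hOut S hS' hS
    exact ⟨S, M, outNielsenFamily hn, hM⟩
  · rw [← image_pairSubgroup_nielsenPairs]
    rintro _ ⟨p, hp, rfl⟩
    exact (hU p hp).nonempty_mulEquiv
  · rw [outNielsenFamily_eq]
    rintro _ ⟨p, hp, rfl⟩
    exact (hU' p hp).nonempty_mulEquiv
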